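/- Write $h$ for the binary entropy function (base $2$) and, for $0<W\le\tfrac12$, let $R_{GP}(W,p)$ be the upper convex envelope, evaluated at $W$, of the curve $\{(w,h(w)-h(p)):0\le w\le\tfrac12\}$ together with the point $(0,0)$. A nested RS/BLBC code is given by: nested Reed–Solomon (cyclic) codes $\mathcal C_2\subset\mathcal C$ of length $n$ and dimensions $k_2<k_1+k_2<n$ over $\mathbb F_{2^m}$ ($k_1,k_2\geq 1$), with generator polynomials $gf$ and $g$, where $\alpha$ has order $n$, $r=n-k_1-k_2$, $g$ has the roots $\alpha,\dots,\alpha^{r}$ and $f$ the roots $\alpha^{r+1},\dots,\alpha^{r+k_1}$; a bijective $\mathbb F_2$-linear map $\phi:\mathbb F_{2^m}^n\to\mathbb F_2^{nm}$; and an injective linear encoder of a binary linear block code (with generator matrix $G_\Psi$) which encodes each of the $l$ groups of $nm/l$ bits of $\phi(\mathbf v)$ ($1\le l\le n$, $l\mid nm$) into $N/l$ bits. Let $\mathcal C_{eq}\supset\mathcal C_{eq2}$ be the resulting binary codes of length $N$, with $K=(k_1+k_2)m$, $K_2=k_2m$, $K_1=k_1m$. Source encoding of a word $x\in\mathbb F_2^N$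 via list decoding with distortion $W$ forms the list of all codewords of $\mathcal C_{eq2}$ within Hamming distance $WN$ of $x$ and selects one closest to $x$; it is an encoding error if the list is empty. Call a sequence of such codes with $N\to\infty$ *good for $W$* if $K_2/N\to 1-h(W)$ and the encoding-error probability for the symmetric Bernoulli source (a uniform $x\in\mathbb F_2^N$) tends to $0$. Together with channel decoders, it *achieves capacity on BSC($p$)* if $K/N\to 1-h(p)$ and the probability of wrong decoding tends to $0$, uniformly over the codewords of $\mathcal C_{eq}$. In the nested scheme with interference $\mathbf S$, uniform on $\mathbb F_2^N$ and known to the encoder, the message $i_1$ ($\deg i_1<k_1$) is mapped to $\mathbf c_1$, the image of $i_1g$; source encoding of $\mathbf S-\mathbf c_1$ with $\mathcal C_{eq2}$ gives $\mathbf c_2$; $\mathbf E=\mathbf S-\mathbf c_1-\mathbf c_2$ is transmitted; and from $\mathbf Y=\mathbf E+\mathbf S+\mathbf Z$, with $\mathbf Z$ i.i.d. $\mathrm{Bern}(p)$ independent of $\mathbf S$, the channel decoder of $\mathcal C_{eq}$ recovers $v$, and $i_1=(v \bmod gf)/g$ is extracted. Time sharing with $(0,0)$ means sending zeros on additional idle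 positions. Such schemes achieve the rate $R$ under the input constraint $W$ if the message rate ($K_1$ divided by the total length) tends to $R$, every transmitted word has relative Hamming weight at most $W$, and the error probability (encoder failure or wrong message) tends to $0$, uniformly over the messages. **Proposition.** Let $0\le p<\tfrac12$. 1. For every $W$ with $p<W\le\tfrac12$ there are nested RS/BLBC codes with $N\to\infty$, with $n=2^m-1$ and with $\phi$ the symbolwise expansion in a basis of $\mathbb F_{2^m}$ over $\mathbb F_2$, which are good for $W$, for which every list of $\mathcal C_{eq2}$ of relative radius $\rho$ has size at most polynomial in $N$, for each fixed $\rho<W$, and which with suitable decoders achieve capacity on BSC($p$). 2. For every $W$ with $p<W\le\tfrac12$ and every sequence of nested RS/BLBC codes and decoders that is good for $W$ and achieves capacity on BSC($p$), the resulting nested scheme achieves the rate $h(W)-h(p)$ under the input constraint $W$. 3. For every $0<W\le\tfrac12$ there is $\omega\in[W,\tfrac12]$ with $\omega>p$, equal to $W$ whenever $R_{GP}(W,p)=h(W)-h(p)$, such that for every sequence of nested RS/BLBC codes and decoders that is good for $\omega$ and achieves capacity on BSC($p$), the nested scheme (with list decoding at distortion $\omega$), time-shared with $(0,0)$ by adding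 $\lceil N(\omega/W-1)\rceil$ idle positions, achieves the capacity-noise bound $R_{GP}(W,p)$ under the input constraint $W$. -/

import Mathlib

open Filter Topology Polynomial

/-! ### Binary words, noise, entropy -/

/-- Binary words of length `N`. -/
abbrev Word (N : ℕ) : Type := Fin N → ZMod 2

/-- The binary entropy function with logarithms to base `2`. -/
noncomputable def h2 (x : ℝ) : ℝ := Real.binEntropy x / Real.log 2

/-- The probability of the noise vector `z` of a `BSC(p)`: its coordinates are i.i.d. `Bern(p)`. -/
noncomputable def noiseProb (p : ℝ) {N : ℕ} (z : Word N) : ℝ :=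
  ∏ i, if z i = 0 then 1 - p else p

/-- The capacity-noise bound: the upper convex envelope, evaluated at `W`, of the curve
`w ↦ h(w) - h(p)`, `0 ≤ w ≤ 1/2`, together with the point `(0,0)`. -/
noncomputable def RGP (W p : ℝ) : ℝ :=
  sSup {y : ℝ | (W, y) ∈ convexHull ℝ
    (insert ((0 : ℝ), (0 : ℝ)) ((fun w : ℝ => (w, h2 w - h2 p)) '' Set.Icc (0 : ℝ) (1 / 2)))}

/-! ### Source encoding by list decoding -/

open Classical in
/-- List decoding of `C` at relative radius `ρ`: all codewords within Hamming distance `ρ N`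
of the word `x`. -/
noncomputable def listDecode {N : ℕ} (C : Submodule (ZMod 2) (Word N)) (ρ : ℝ) (x : Word N) :
    Finset (Word N) :=
  Finset.univ.filter fun c => c ∈ C ∧ (hammingDist x c : ℝ) ≤ ρ * N

open Classical in
/-- Source encoding by list decoding: pick a codeword of the list that is closest to `x`.
An encoding error (`none`) is declared when the list is empty. -/
noncomputable def listEncode {N : ℕ} (C : Submodule (ZMod 2) (Word N)) (ρ : ℝ) (x : Word N) :
    Option (Word N) :=
  if hx : (listDecode C ρ x).Nonempty then
    some (Finset.exists_min_image (listDecode C ρ x) (hammingDist x) hx).choose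
  else none

open Classical in
/-- The probability of an encoding error for a symmetric Bernoulli source, that is, for a
uniformly distributed source word. -/
noncomputable def srcErr {N : ℕ} (C : Submodule (ZMod 2) (Word N)) (ρ : ℝ) : ℝ :=
  ((Finset.univ.filter fun x : Word N => listEncode C ρ x = none).card : ℝ) / 2 ^ N

/-! ### Cyclic codes given by generator polynomials -/

/-- The vector of the coefficients of degree `< n` of a polynomial. -/
noncomputable def coeffVec (F : Type) [Field F] (n : ℕ) : F[X] →ₗ[F] (Fin n → F) :=
  LinearMap.pi fun j => Polynomial.lcoeff F (j : ℕ)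

/-- The polynomial with a given coefficient vector. -/
noncomputable def vecPoly {F : Type} [Field F] {n : ℕ} (v : Fin n → F) : F[X] :=
  ∑ j : Fin n, Polynomial.monomial (j : ℕ) (v j)

/-- The code of length `n` and dimension `k` with generator polynomial `g` (coefficient vectors of
the products `i g` with `deg i < k`). -/
noncomputable def polyCode {F : Type} [Field F] (n k : ℕ) (g : F[X]) : Submodule F (Fin n → F) :=
  (Polynomial.degreeLT F k).map (coeffVec F n ∘ₗ LinearMap.mulRight F g)

/-! ### Nested concatenated RS/BLBC codes -/

/-- The data of a nested concatenated code: nested Reed-Solomon codes of length `n` and dimensions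
`k₂ < k₁ + k₂` over the field with `2 ^ m` elements as outer codes; a bijective linear
translation `φ` of outer words into binary sequences of length `n m`; and a binary linear inner
code of length `M` with generator matrix `G` (with independent rows), which encodes each of the
`l` groups of `b = n m / l` bits. -/
structure NestedRS where
  m : ℕ
  n : ℕ
  k₁ : ℕ
  k₂ : ℕ
  l : ℕ
  b : ℕ
  M : ℕ
  m_pos : 0 < m
  k₁_pos : 0 < k₁
  k₂_pos : 0 < k₂
  k_lt : k₁ + k₂ < n
  l_pos : 0 < l
  l_le : l ≤ n
  groups : l * b = n * m
  α : GaloisField 2 m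
  order_α : orderOf α = n
  φ : (Fin n → GaloisField 2 m) ≃ₗ[ZMod 2] Word (n * m)
  G : Matrix (Fin b) (Fin M) (ZMod 2)
  G_inj : Function.Injective fun u : Fin b → ZMod 2 => Matrix.vecMul u G

namespace NestedRS

variable (S : NestedRS)

/-- The outer alphabet. -/
abbrev F : Type := GaloisField 2 S.m

/-- The length of the concatenated binary code. -/
def N : ℕ := S.l * S.M

/-- The generator polynomial `g`, of degree `r = n - (k₁ + k₂)`, with roots `α, …, α ^ r`. -/
noncomputable def g : S.F[X] :=
  ∏ j ∈ Finset.Icc 1 (S.n - (S.k₁ + S.k₂)), (X - Polynomial.C (S.α ^ j))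

/-- The polynomial `f`, of degree `k₁`, with roots `α ^ (r + 1), …, α ^ (r + k₁)`. -/
noncomputable def f : S.F[X] :=
  ∏ j ∈ Finset.Icc (S.n - (S.k₁ + S.k₂) + 1) (S.n - (S.k₁ + S.k₂) + S.k₁),
    (X - Polynomial.C (S.α ^ j))

/-- The outer Reed-Solomon code. -/
noncomputable def outer : Submodule S.F (Fin S.n → S.F) := polyCode S.n (S.k₁ + S.k₂) S.g

/-- The nested outer Reed-Solomon code, with generator polynomial `g f`. -/
noncomputable def outer₂ : Submodule S.F (Fin S.n → S.F) := polyCode S.n S.k₂ (S.g * S.f)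

/-- The blockwise inner encoder `u ↦ (u₁ G, …, u_l G)`. -/
def innerMap : Word (S.n * S.m) →ₗ[ZMod 2] Word S.N where
  toFun u := fun x : Fin (S.l * S.M) =>
    Matrix.vecMul (fun j : Fin S.b => u (Fin.cast S.groups (finProdFinEquiv (x.divNat, j)))) S.G
      x.modNat
  map_add' u v := by
    funext x
    simp only [Matrix.vecMul, dotProduct, Pi.add_apply, add_mul, Finset.sum_add_distrib]
    rfl
  map_smul' a u := by
    funext x
    simp only [Matrix.vecMul, dotProduct, Pi.smul_apply, smul_eq_mul, mul_assoc,
      ← Finset.mul_sum, RingHom.id_apply]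
    rfl

/-- The concatenated encoder of outer words. -/
noncomputable def conc : (Fin S.n → S.F) →ₗ[ZMod 2] Word S.N :=
  S.innerMap ∘ₗ S.φ.toLinearMap

/-- The nested concatenated binary code (the source code). The channel code is the image under
`S.conc` of `S.outer`. -/
noncomputable def Ceq₂ : Submodule (ZMod 2) (Word S.N) :=
  (S.outer₂.restrictScalars (ZMod 2)).map S.conc

/-- The rate of the channel code. -/
noncomputable def rate : ℝ := ((S.k₁ + S.k₂ : ℕ) * S.m : ℝ) / S.N

/-- The rate of the source code. -/
noncomputable def rate₂ : ℝ := (S.k₂ * S.m : ℝ) / S.N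

/-- The translation `φ` expands every outer symbol in a fixed basis of the outer alphabet. -/
def Symbolwise : Prop :=
  ∃ β : Module.Basis (Fin S.m) (ZMod 2) S.F,
    ∀ (v : Fin S.n → S.F) (i : Fin S.n) (j : Fin S.m),
      S.φ v (finProdFinEquiv (i, j)) = β.repr (v i) j

/-- A channel decoder: it maps the received word to an outer word. -/
abbrev Decoder : Type := Word S.N → (Fin S.n → S.F)

open Classical in
/-- The probability over `BSC(p)` that the decoder does not recover the outer word `v`. -/
noncomputable def chanErr (D : S.Decoder) (p : ℝ) (v : Fin S.n → S.F) : ℝ :=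
  ∑ z : Word S.N, if D (S.conc v + z) = v then 0 else noiseProb p z

/-- The codeword `c₁` carrying the information polynomial `i₁` (of degree `< k₁`). -/
noncomputable def infoWord (i₁ : S.F[X]) : Word S.N := S.conc (coeffVec S.F S.n (i₁ * S.g))

/-- Recovery of the information polynomial, `i₁ = (v mod g f) / g`. -/
noncomputable def extract (v : Fin S.n → S.F) : S.F[X] := (vecPoly v %ₘ (S.g * S.f)) /ₘ S.g

/-- The encoder with side information `s`: source encoding of `s - c₁` by list decoding of the
nested code with distortion `ω` gives `c₂`, and `e = s - c₁ - c₂` is transmitted. -/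
noncomputable def encode (ω : ℝ) (i₁ : S.F[X]) (s : Word S.N) : Option (Word S.N) :=
  (listEncode S.Ceq₂ ω (s - S.infoWord i₁)).map fun c₂ => s - S.infoWord i₁ - c₂

/-- The encoder time-shared with the point `(0,0)`: it is used on the first `N` positions and the
zero word is sent on `a` further idle positions. -/
noncomputable def encodeTS (ω : ℝ) (a : ℕ) (i₁ : S.F[X]) (s : Word (S.N + a)) :
    Option (Word (S.N + a)) :=
  (S.encode ω i₁ fun j => s (Fin.castAdd a j)).map fun e => Fin.append e 0

open Classical in
/-- The error probability of the (time-shared) scheme for the message `i₁`: the interference `s` is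
uniform, the noise `z` is independent of it and i.i.d. `Bern(p)`, the channel output is
`y = e + s + z`; an error occurs if the encoder fails or `i₁` is not recovered from `y`. -/
noncomputable def schemeErr (D : S.Decoder) (ω p : ℝ) (a : ℕ) (i₁ : S.F[X]) : ℝ :=
  (∑ s : Word (S.N + a), ∑ z : Word (S.N + a),
    if ∃ e, S.encodeTS ω a i₁ s = some e ∧
        S.extract (D fun j => (e + s + z) (Fin.castAdd a j)) = i₁
    then 0 else noiseProb p z) / 2 ^ (S.N + a)

end NestedRS

/-! ### Asymptotic notions for sequences of codes -/

/-- The nested codes are asymptotically optimal `W`-distortion source codes for the symmetric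
Bernoulli source under source encoding by list decoding: the rates tend to `1 - h(W)` and the
probability of an encoding error vanishes. -/
structure GoodSourceCodes (S : ℕ → NestedRS) (W : ℝ) : Prop where
  rate : Tendsto (fun i => (S i).rate₂) atTop (𝓝 (1 - h2 W))
  err : Tendsto (fun i => srcErr (S i).Ceq₂ W) atTop (𝓝 0)

/-- The concatenated codes with decoders `D` asymptotically achieve the capacity `1 - h(p)` of
`BSC(p)`. -/
structure AchieveCapacity (S : ℕ → NestedRS) (D : ∀ i, (S i).Decoder) (p : ℝ) : Prop where
  rate : Tendsto (fun i => (S i).rate) atTop (𝓝 (1 - h2 p))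
  err : ∀ ε > 0, ∀ᶠ i in atTop, ∀ v ∈ (S i).outer, (S i).chanErr (D i) p v ≤ ε

/-- The nested schemes with list radius `ω` and `a i` idle positions achieve the rate `R` over
`BSC(p)` with side information at the encoder, under the input constraint `W`: the message rates
`K₁ / (N + a)` tend to `R`, everything transmitted satisfies the constraint, and the error
probability vanishes, uniformly over the messages. -/
structure SchemesAchieve (S : ℕ → NestedRS) (D : ∀ i, (S i).Decoder) (ω : ℝ) (a : ℕ → ℕ)
    (W p R : ℝ) : Prop where
  rate : Tendsto (fun i => ((S i).k₁ * (S i).m : ℝ) / ((S i).N + a i : ℕ)) atTop (𝓝 R)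
  constr : ∀ i, ∀ i₁ ∈ Polynomial.degreeLT (S i).F (S i).k₁, ∀ s e : Word ((S i).N + a i),
    (S i).encodeTS ω (a i) i₁ s = some e → (hammingNorm e : ℝ) / ((S i).N + a i : ℕ) ≤ W
  err : ∀ ε > 0, ∀ᶠ i in atTop, ∀ i₁ ∈ Polynomial.degreeLT (S i).F (S i).k₁,
    (S i).schemeErr (D i) ω p (a i) i₁ ≤ ε

/-! The nested scheme is governed by one identity. In characteristic two the interference cancels:
if `e = s - c₁ - c₂` is sent, then `e + s = c₁ + c₂`, the image of the outer word `i₁ g + i₂ g f`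
(`NestedRS.encode_eq_some`). The decoder thus sees a codeword of the channel code plus Bernoulli
noise. Since `i₁ g` has degree below that of `g f`, it is the remainder modulo `g f`, so the message
can be read off (`NestedRS.extract_add`). As `s - c₁` is uniform when `s` is, encoder failure has
exactly the source-coding error probability. Hence the scheme error is at most the source error plus
the worst channel error (`NestedRS.schemeErr_le`), and the rate is the difference of the two code
rates, scaled by the idling factor (`GoodSourceCodes.schemesAchieve`).

The capacity-noise bound becomes an optimisation of the slope of the chord from the origin to the
curve over `[W, 1/2]`. Concavity of the entropy shows that the best chord attains the envelope
(`exists_RGP_eq`).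

Existence of good codes is a random coding argument with a single group of bits, `l = 1`. The inner
code is then an invertible square matrix, so the concatenated encoder can be any linear bijection. A
uniform linear map sends independent vectors to independent uniform words. A second moment gives
covering by the source code, a union bound gives decoding, and a first moment over linearly
independent tuples gives short lists; one map has all these properties (`exists_good_linearMap`).
The chosen map is injective on the outer code, so it agrees there with a bijection
(`exists_linearEquiv_eqOn`). The growth rate of Hamming balls (`tendsto_logb_ballCard`) turns the
counting conditions into the rates `1 - h(W)` and `1 - h(p)`. Rounding dimensions to whole symbols
costs a few times `m` bits out of `m (2 ^ m - 1)`, which is negligible. -/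

/-! ### Words and noise -/

/-- Words of length `N + a` as pairs of words of lengths `N` and `a`. -/
def wordSplit (N a : ℕ) : Word (N + a) ≃ Word N × Word a where
  toFun s := (fun j => s (Fin.castAdd a j), fun j => s (Fin.natAdd N j))
  invFun q := Fin.append q.1 q.2
  left_inv s := by
    funext j
    refine Fin.addCases (fun j => ?_) (fun j => ?_) j <;> simp
  right_inv q := by ext <;> simp

theorem card_word (N : ℕ) : Fintype.card (Word N) = 2 ^ N := by
  simp [Word, ZMod.card]

theorem noiseProb_nonneg {p : ℝ} (hp₀ : 0 ≤ p) (hp₁ : p ≤ 1) {N : ℕ} (z : Word N) :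
    0 ≤ noiseProb p z := by
  refine Finset.prod_nonneg fun i _ => ?_
  split_ifs <;> linarith

theorem sum_noiseProb (p : ℝ) (N : ℕ) : ∑ z : Word N, noiseProb p z = 1 := by
  unfold noiseProb
  rw [← Fintype.prod_sum (fun (_ : Fin N) (x : ZMod 2) => if x = 0 then 1 - p else p)]
  refine Finset.prod_eq_one fun i _ => ?_
  have : (Finset.univ : Finset (ZMod 2)) = {0, 1} := rfl
  rw [this, Finset.sum_pair (by decide)]
  simp

theorem noiseProb_wordSplit_symm (p : ℝ) {N a : ℕ} (q : Word N × Word a) :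
    noiseProb p ((wordSplit N a).symm q) = noiseProb p q.1 * noiseProb p q.2 := by
  simp [noiseProb, wordSplit, Fin.prod_univ_add]

/-- The noise on the idle positions is independent of the rest and integrates to one. -/
theorem sum_noiseProb_castAdd (p : ℝ) {N a : ℕ} (H : Word N → ℝ) :
    ∑ z : Word (N + a), H (fun j => z (Fin.castAdd a j)) * noiseProb p z
      = ∑ z : Word N, H z * noiseProb p z := by
  rw [← (wordSplit N a).symm.sum_comp, Fintype.sum_prod_type]
  refine Finset.sum_congr rfl fun x _ => ?_
  simp_rw [noiseProb_wordSplit_symm]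
  have : ∀ y : Word a, (fun j => (wordSplit N a).symm (x, y) (Fin.castAdd a j)) = x := by
    intro y; funext j; simp [wordSplit]
  simp_rw [this, ← mul_assoc, ← Finset.mul_sum, sum_noiseProb, mul_one]

theorem sum_castAdd {N a : ℕ} (H : Word N → ℝ) :
    ∑ s : Word (N + a), H (fun j => s (Fin.castAdd a j)) = 2 ^ a * ∑ x : Word N, H x := by
  rw [← (wordSplit N a).symm.sum_comp, Fintype.sum_prod_type, Finset.mul_sum]
  refine Finset.sum_congr rfl fun x _ => ?_
  have : ∀ y : Word a, (fun j => (wordSplit N a).symm (x, y) (Fin.castAdd a j)) = x := by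
    intro y; funext j; simp [wordSplit]
  simp_rw [this, Finset.sum_const, Finset.card_univ, card_word]
  simp

theorem Word.sub_eq_add {N : ℕ} (x y : Word N) : x - y = x + y := by
  funext i
  exact CharTwo.sub_eq_add _ _

theorem Word.hammingDist_eq {N : ℕ} (x y : Word N) : hammingDist x y = hammingNorm (x - y) := by
  rw [hammingDist_eq_hammingNorm]
  congr 1
  funext i
  simp [CharTwo.sub_eq_add, CharTwo.neg_eq]

theorem hammingNorm_eq_sum {N : ℕ} (x : Word N) :
    hammingNorm x = ∑ i, if x i = 0 then 0 else 1 := by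
  simp [hammingNorm, Finset.card_filter]

/-! ### Source encoding -/

theorem mem_listDecode {N : ℕ} {C : Submodule (ZMod 2) (Word N)} {ρ : ℝ} {x c : Word N} :
    c ∈ listDecode C ρ x ↔ c ∈ C ∧ (hammingDist x c : ℝ) ≤ ρ * N := by
  simp [listDecode]

theorem listEncode_eq_some {N : ℕ} {C : Submodule (ZMod 2) (Word N)} {ρ : ℝ} {x c : Word N}
    (hc : listEncode C ρ x = some c) : c ∈ C ∧ (hammingDist x c : ℝ) ≤ ρ * N := by
  unfold listEncode at hc
  split_ifs at hc with hx
  rw [← mem_listDecode, ← Option.some.inj hc]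
  exact (Finset.exists_min_image (listDecode C ρ x) (hammingDist x) hx).choose_spec.1

theorem listEncode_eq_none_iff {N : ℕ} {C : Submodule (ZMod 2) (Word N)} {ρ : ℝ} {x : Word N} :
    listEncode C ρ x = none ↔ ∀ c ∈ C, ¬ (hammingDist x c : ℝ) ≤ ρ * N := by
  unfold listEncode
  split_ifs with hx
  · obtain ⟨c, hc⟩ := hx
    rw [mem_listDecode] at hc
    simp only [false_iff]
    exact fun h => h c hc.1 hc.2
  · simp only [true_iff]
    intro c hc hd
    exact hx ⟨c, mem_listDecode.2 ⟨hc, hd⟩⟩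

open Classical in
theorem srcErr_eq_sum {N : ℕ} (C : Submodule (ZMod 2) (Word N)) (ρ : ℝ) :
    srcErr C ρ = (∑ x : Word N, if listEncode C ρ x = none then (1 : ℝ) else 0) / 2 ^ N := by
  simp [srcErr, Finset.sum_boole]

/-! ### Codes given by generator polynomials -/

theorem vecPoly_coeffVec {F : Type} [Field F] {n : ℕ} {q : F[X]} (hq : q.degree < n) :
    vecPoly (coeffVec F n q) = q := by
  ext k
  simp only [vecPoly, coeffVec, Polynomial.finsetSum_coeff, LinearMap.pi_apply, lcoeff_apply,
    coeff_monomial]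
  by_cases hk : k < n
  · rw [Finset.sum_eq_single (⟨k, hk⟩ : Fin n)]
    · simp
    · intro j _ hj
      rw [if_neg]
      intro h
      exact hj (Fin.ext h)
    · simp
  · rw [Polynomial.coeff_eq_zero_of_degree_lt (hq.trans_le (by exact_mod_cast not_lt.1 hk))]
    refine Finset.sum_eq_zero fun j _ => if_neg ?_
    have := j.2
    omega

theorem mem_polyCode {F : Type} [Field F] {n k : ℕ} {g : F[X]} {v : Fin n → F} :
    v ∈ polyCode n k g ↔ ∃ i : F[X], i.degree < k ∧ coeffVec F n (i * g) = v := by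
  simp [polyCode, Submodule.mem_map, Polynomial.mem_degreeLT]

theorem degree_mul_lt {F : Type} [Field F] {k : ℕ} {i g : F[X]} (hg : g.Monic)
    (hi : i.degree < k) : (i * g).degree < (k + g.natDegree : ℕ) := by
  by_cases h0 : i = 0
  · simp only [h0, zero_mul, degree_zero]
    exact WithBot.bot_lt_coe _
  · rw [Polynomial.degree_mul, degree_eq_natDegree hg.ne_zero, degree_eq_natDegree h0] at *
    norm_cast at *
    omega

namespace NestedRS

variable (S : NestedRS)

theorem g_monic : S.g.Monic := monic_prod_of_monic _ _ fun _ _ => monic_X_sub_C _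

theorem f_monic : S.f.Monic := monic_prod_of_monic _ _ fun _ _ => monic_X_sub_C _

theorem natDegree_g : S.g.natDegree = S.n - (S.k₁ + S.k₂) := by
  rw [g, natDegree_prod_of_monic _ _ fun _ _ => monic_X_sub_C _]
  simp only [natDegree_X_sub_C]
  simp

theorem natDegree_f : S.f.natDegree = S.k₁ := by
  rw [f, natDegree_prod_of_monic _ _ fun _ _ => monic_X_sub_C _]
  simp only [natDegree_X_sub_C]
  simp

theorem natDegree_gf : (S.g * S.f).natDegree = S.n - S.k₂ := by
  rw [S.g_monic.natDegree_mul S.f_monic, natDegree_g, natDegree_f]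
  have := S.k_lt
  omega

/-- All degrees stay below `n`, so no coefficient is lost. Moreover `i₁ g` has degree below `n -
k₂`, the degree of `g f`, so it is the remainder in the division by `g f`. -/
theorem extract_add {i₁ i₂ : S.F[X]} (h₁ : i₁.degree < S.k₁) (h₂ : i₂.degree < S.k₂) :
    S.extract (coeffVec S.F S.n (i₁ * S.g) + coeffVec S.F S.n (i₂ * (S.g * S.f))) = i₁ := by
  have hk := S.k_lt
  have d₁ := degree_mul_lt S.g_monic h₁
  have d₂ := degree_mul_lt (S.g_monic.mul S.f_monic) h₂
  rw [natDegree_g] at d₁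
  rw [natDegree_gf] at d₂
  have e₁ : S.k₁ + (S.n - (S.k₁ + S.k₂)) = S.n - S.k₂ := by omega
  have e₂ : S.k₂ + (S.n - S.k₂) = S.n := by omega
  rw [e₁] at d₁
  rw [e₂] at d₂
  have d₁' : (i₁ * S.g).degree < S.n := d₁.trans_le (by exact_mod_cast Nat.sub_le _ _)
  rw [← map_add, extract, vecPoly_coeffVec ((degree_add_le _ _).trans_lt (max_lt d₁' d₂)),
    add_comm, mul_comm i₂,
    (div_modByMonic_unique i₂ (i₁ * S.g) (S.g_monic.mul S.f_monic)
      ⟨by rw [add_comm], by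
        rwa [degree_eq_natDegree (S.g_monic.mul S.f_monic).ne_zero, natDegree_gf]⟩).2,
    mul_comm, mul_divByMonic_cancel_left _ S.g_monic]

theorem add_mem_outer {i₁ i₂ : S.F[X]} (h₁ : i₁.degree < S.k₁) (h₂ : i₂.degree < S.k₂) :
    coeffVec S.F S.n (i₁ * S.g) + coeffVec S.F S.n (i₂ * (S.g * S.f)) ∈ S.outer := by
  refine mem_polyCode.2 ⟨i₁ + i₂ * S.f, ?_, by rw [← map_add]; congr 1; ring⟩
  refine (degree_add_le _ _).trans_lt (max_lt (h₁.trans_le ?_) ?_)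
  · exact_mod_cast Nat.le_add_right _ _
  · have := degree_mul_lt S.f_monic h₂
    rwa [natDegree_f, add_comm] at this

theorem outer₂_le_outer : S.outer₂ ≤ S.outer := by
  intro v hv
  obtain ⟨i₂, h₂, rfl⟩ := mem_polyCode.1 hv
  simpa using S.add_mem_outer (i₁ := 0) (by simp) h₂

/-! ### The nested scheme -/

/-- Because `s + s = 0`, adding the interference to the transmitted word leaves `c₁ + c₂`. The
weight of `e` is the distance from `s - c₁` to `c₂`, which the list radius bounds. -/
theorem encode_eq_some {ω : ℝ} {i₁ : S.F[X]} {s e : Word S.N} (he : S.encode ω i₁ s = some e) :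
    (hammingNorm e : ℝ) ≤ ω * S.N ∧
      ∃ i₂ : S.F[X], i₂.degree < S.k₂ ∧
        e + s = S.conc (coeffVec S.F S.n (i₁ * S.g) + coeffVec S.F S.n (i₂ * (S.g * S.f))) := by
  obtain ⟨c₂, hc₂, rfl⟩ := Option.map_eq_some_iff.1 he
  obtain ⟨hmem, hd⟩ := listEncode_eq_some hc₂
  rw [Word.hammingDist_eq] at hd
  refine ⟨hd, ?_⟩
  obtain ⟨v, hv, rfl⟩ := (Submodule.mem_map).1 hmem
  obtain ⟨i₂, h₂, rfl⟩ := mem_polyCode.1 ((Submodule.restrictScalars_mem _ _ _).1 hv)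
  refine ⟨i₂, h₂, ?_⟩
  rw [map_add, infoWord]
  generalize S.conc (coeffVec S.F S.n (i₁ * S.g)) = x
  generalize S.conc (coeffVec S.F S.n (i₂ * (S.g * S.f))) = y
  simp only [Word.sub_eq_add]
  rw [show s + x + y + s = (x + y) + (s + s) by abel, ← Word.sub_eq_add s s, sub_self, add_zero]

/-- Idle positions add length but no weight: the condition on `a` says that `ω N ≤ W (N + a)`. -/
theorem constr_encodeTS {ω W : ℝ} (hW : 0 < W) {a : ℕ} (ha : (S.N : ℝ) * (ω / W - 1) ≤ a)
    {i₁ : S.F[X]} {s e : Word (S.N + a)} (he : S.encodeTS ω a i₁ s = some e) :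
    (hammingNorm e : ℝ) / (S.N + a : ℕ) ≤ W := by
  obtain ⟨e', he', rfl⟩ := Option.map_eq_some_iff.1 he
  have h := (S.encode_eq_some he').1
  refine div_le_of_le_mul₀ (by positivity) hW.le ?_
  have h' : hammingNorm (Fin.append e' (0 : Word a) : Word (S.N + a)) = hammingNorm e' := by
    simp [hammingNorm_eq_sum, Fin.sum_univ_add]
  rw [h']
  refine h.trans ?_
  push_cast
  have : W * ((S.N : ℝ) + S.N * (ω / W - 1)) = ω * S.N := by field_simp; ring
  rw [← this]
  gcongr

theorem chanErr_nonneg {p : ℝ} (hp₀ : 0 ≤ p) (hp₁ : p ≤ 1) (D : S.Decoder) (v : Fin S.n → S.F) :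
    0 ≤ S.chanErr D p v := by
  refine Finset.sum_nonneg fun z _ => ?_
  split_ifs
  · exact le_rfl
  · exact noiseProb_nonneg hp₀ hp₁ z

-- For fixed interference there are two cases. If the encoder fails, the whole noise mass is at most
-- one. Otherwise the outer word is determined by `s` and `i₁`, and the noise is averaged against
-- that single codeword. The codeword varies with `s`, which is why the channel bound is required
-- uniformly over `S.outer`.
open Classical in
theorem sum_noise_le {p ε : ℝ} (hp₀ : 0 ≤ p) (hp₁ : p ≤ 1) {D : S.Decoder}
    (hD : ∀ v ∈ S.outer, S.chanErr D p v ≤ ε) {ω : ℝ} {a : ℕ} {i₁ : S.F[X]}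
    (h₁ : i₁.degree < S.k₁) (s : Word (S.N + a)) :
    (∑ z : Word (S.N + a), if ∃ e, S.encodeTS ω a i₁ s = some e ∧
        S.extract (D fun j => (e + s + z) (Fin.castAdd a j)) = i₁ then 0 else noiseProb p z) ≤
      (if listEncode S.Ceq₂ ω ((fun j => s (Fin.castAdd a j)) - S.infoWord i₁) = none
        then 1 else 0) + ε := by
  have hε : 0 ≤ ε := (S.chanErr_nonneg hp₀ hp₁ D 0).trans (hD 0 (zero_mem _))
  split_ifs with hn
  · refine le_add_of_le_of_nonneg ?_ hε
    rw [← sum_noiseProb p (S.N + a)]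
    refine Finset.sum_le_sum fun z _ => ?_
    split_ifs
    · exact noiseProb_nonneg hp₀ hp₁ z
    · exact le_rfl
  · set s' : Word S.N := fun j => s (Fin.castAdd a j) with hs'
    obtain ⟨c₂, hc₂⟩ := Option.ne_none_iff_exists'.1 hn
    have he : S.encode ω i₁ s' = some (s' - S.infoWord i₁ - c₂) := by
      rw [encode, hc₂, Option.map_some]
    set e' := s' - S.infoWord i₁ - c₂
    have heTS : S.encodeTS ω a i₁ s = some (Fin.append e' 0) := by
      rw [encodeTS, ← hs', he, Option.map_some]
    obtain ⟨i₂, h₂, hes⟩ := (S.encode_eq_some he).2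
    rw [zero_add]
    refine le_trans ?_ (hD _ (S.add_mem_outer h₁ h₂))
    set v := coeffVec S.F S.n (i₁ * S.g) + coeffVec S.F S.n (i₂ * (S.g * S.f)) with hv
    have key := sum_noiseProb_castAdd p (a := a)
      (fun z : Word S.N => if D (S.conc v + z) = v then 0 else 1)
    simp only [ite_mul, zero_mul, one_mul] at key
    rw [chanErr, ← key]
    refine Finset.sum_le_sum fun z _ => ?_
    by_cases hz : D (S.conc v + fun j => z (Fin.castAdd a j)) = v
    · rw [if_pos hz, if_pos]
      refine ⟨_, heTS, ?_⟩
      have : (fun j => (Fin.append e' (0 : Word a) + s + z : Word (S.N + a)) (Fin.castAdd a j))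
          = S.conc v + fun j => z (Fin.castAdd a j) := by
        rw [← hes]
        funext j
        simp [hs']
      rw [this, hz, hv, S.extract_add h₁ h₂]
    · rw [if_neg hz]
      split_ifs
      · exact noiseProb_nonneg hp₀ hp₁ z
      · exact le_rfl

/-- Translation by `c₁` preserves the uniform distribution, so the failure probability of the
encoder does not depend on the message. -/
theorem schemeErr_le {p ε : ℝ} (hp₀ : 0 ≤ p) (hp₁ : p ≤ 1) {D : S.Decoder}
    (hD : ∀ v ∈ S.outer, S.chanErr D p v ≤ ε) (ω : ℝ) (a : ℕ) {i₁ : S.F[X]}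
    (h₁ : i₁.degree < S.k₁) : S.schemeErr D ω p a i₁ ≤ srcErr S.Ceq₂ ω + ε := by
  classical
  rw [schemeErr, div_le_iff₀ (by positivity)]
  refine (Finset.sum_le_sum fun s _ => S.sum_noise_le hp₀ hp₁ hD h₁ s).trans_eq ?_
  rw [Finset.sum_add_distrib, sum_castAdd (a := a) fun x : Word S.N =>
    if listEncode S.Ceq₂ ω (x - S.infoWord i₁) = none then (1 : ℝ) else 0]
  have e := (Equiv.subRight (S.infoWord i₁)).sum_comp
    (fun x : Word S.N => if listEncode S.Ceq₂ ω x = none then (1 : ℝ) else 0)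
  simp only [Equiv.subRight_apply] at e
  rw [e, Finset.sum_const, Finset.card_univ, card_word, srcErr_eq_sum, pow_add]
  rw [nsmul_eq_mul]
  push_cast
  field_simp
  ring

end NestedRS

/-- A sequence of good source codes that achieves the channel capacity gives schemes whose error
vanishes and whose rate is reduced by idling. -/
theorem GoodSourceCodes.schemesAchieve {S : ℕ → NestedRS} {D : ∀ i, (S i).Decoder} {p ω W : ℝ}
    (hp₀ : 0 ≤ p) (hp₁ : p ≤ 1) (hW : 0 < W) (hω : 0 < ω)
    (hS : GoodSourceCodes S ω) (hD : AchieveCapacity S D p) {a : ℕ → ℕ}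
    (ha : ∀ i, ((S i).N : ℝ) * (ω / W - 1) ≤ a i)
    (haN : Tendsto (fun i => (a i : ℝ) / (S i).N) atTop (𝓝 (ω / W - 1)))
    (hN : Tendsto (fun i => (S i).N) atTop atTop) :
    SchemesAchieve S D ω a W p (W / ω * (h2 ω - h2 p)) where
  rate := by
    -- `K₁ = K - K₂`, and `K₁ / (N + a)` is `K₁ / N` divided by `1 + a / N`.
    have h := (hD.rate.sub hS.rate).div (haN.const_add 1)
      (by rw [add_sub_cancel]; positivity)
    have e : (1 - h2 p - (1 - h2 ω)) / (1 + (ω / W - 1)) = W / ω * (h2 ω - h2 p) := by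
      rw [add_sub_cancel]; field_simp; ring
    rw [e] at h
    refine h.congr' ?_
    filter_upwards [hN.eventually_gt_atTop 0] with i hi
    have hi' : (0 : ℝ) < (S i).N := by exact_mod_cast hi
    simp only [NestedRS.rate, NestedRS.rate₂, Pi.div_apply]
    push_cast
    field_simp
    ring
  constr i i₁ _ s e he := (S i).constr_encodeTS hW (ha i) he
  err ε hε := by
    filter_upwards [hD.err (ε / 2) (by positivity), hS.err.eventually_le_const (half_pos hε)]
      with i h₁ h₂ i₁ hi₁
    have := (S i).schemeErr_le hp₀ hp₁ h₁ ω (a i) (Polynomial.mem_degreeLT.1 hi₁)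
    linarith

/-! ### The entropy function and the capacity-noise bound -/

theorem log_two_pos : 0 < Real.log 2 := Real.log_pos one_lt_two

theorem continuous_h2 : Continuous h2 := by
  unfold h2
  fun_prop

@[simp] theorem h2_zero : h2 0 = 0 := by simp [h2]

@[simp] theorem h2_half : h2 (1 / 2) = 1 := by
  rw [h2, one_div, Real.binEntropy_two_inv, div_self log_two_pos.ne']

theorem h2_strictMonoOn : StrictMonoOn h2 (Set.Icc 0 (1 / 2)) := by
  intro x hx y hy hxy
  rw [one_div] at hx hy
  exact div_lt_div_of_pos_right (Real.binEntropy_strictMonoOn hx hy hxy) log_two_pos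

theorem h2_nonneg {x : ℝ} (h₀ : 0 ≤ x) (h₁ : x ≤ 1) : 0 ≤ h2 x :=
  div_nonneg (Real.binEntropy_nonneg h₀ h₁) log_two_pos.le

/-- The binary entropy function lies below its tangents. -/
theorem h2_le_tangent {W : ℝ} (h₀ : 0 < W) (h₁ : W < 1) :
    ∃ d : ℝ, ∀ w ∈ Set.Icc (0 : ℝ) 1, h2 w ≤ h2 W + d * (w - W) := by
  have hc : ConcaveOn ℝ (Set.Icc 0 1) Real.binEntropy := Real.strictConcave_binEntropy.concaveOn
  have hd := Real.hasDerivAt_binEntropy h₀.ne' h₁.ne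
  refine ⟨(Real.log (1 - W) - Real.log W) / Real.log 2, fun w hw => ?_⟩
  have hW : W ∈ Set.Icc (0 : ℝ) 1 := ⟨h₀.le, h₁.le⟩
  have key : Real.binEntropy w ≤
      Real.binEntropy W + (Real.log (1 - W) - Real.log W) * (w - W) := by
    rcases lt_trichotomy w W with h | rfl | h
    · have := hc.le_slope_of_hasDerivAt hw hW h hd
      rw [slope_def_field, le_div_iff₀ (by linarith)] at this
      linarith
    · simp
    · have := hc.slope_le_of_hasDerivAt hW hw h hd
      rw [slope_def_field, div_le_iff₀ (by linarith)] at this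
      linarith
  have := div_le_div_of_nonneg_right key log_two_pos.le
  unfold h2
  calc _ ≤ _ := this
    _ = _ := by ring

/-- The region under a line is convex. Upper bounds for the envelope come from lines above the curve
and the origin. -/
theorem snd_le_of_mem_convexHull {A : Set (ℝ × ℝ)} {c d : ℝ} (hA : ∀ q ∈ A, q.2 ≤ c + d * q.1)
    {q : ℝ × ℝ} (hq : q ∈ convexHull ℝ A) : q.2 ≤ c + d * q.1 := by
  have hconv : Convex ℝ {q : ℝ × ℝ | q.2 ≤ c + d * q.1} := by
    intro x hx y hy a b ha hb hab
    simp only [Set.mem_ofPred_eq, Prod.snd_add, Prod.smul_snd, smul_eq_mul, Prod.fst_add,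
      Prod.smul_fst] at *
    have : c = a * c + b * c := by rw [← add_mul, hab, one_mul]
    nlinarith [mul_le_mul_of_nonneg_left hx ha, mul_le_mul_of_nonneg_left hy hb]
  exact convexHull_min hA hconv hq

/-- The capacity-noise bound is attained by time sharing between the origin and a point of the
curve to the right of `W`. -/
theorem exists_RGP_eq {p W : ℝ} (hp₀ : 0 ≤ p) (hp : p < 1 / 2) (hW₀ : 0 < W) (hW : W ≤ 1 / 2) :
    ∃ ω : ℝ, p < ω ∧ W ≤ ω ∧ ω ≤ 1 / 2 ∧ (RGP W p = h2 W - h2 p → ω = W) ∧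
      RGP W p = W / ω * (h2 ω - h2 p) := by
  set sl : ℝ → ℝ := fun w => (h2 w - h2 p) / w with hsl
  have hcont : ContinuousOn sl (Set.Icc W (1 / 2)) :=
    (continuous_h2.continuousOn.sub continuousOn_const).div continuousOn_id
      fun x hx => (hW₀.trans_le hx.1).ne'
  -- `sl w` is the slope of the chord from the origin to the curve at `w`. Its maximiser on `[W,
  -- 1/2]` gives the best time sharing. The slope at `1/2` is positive, which forces `p < ω`.
  obtain ⟨ω, hω, hmax⟩ := isCompact_Icc.exists_isMaxOn (Set.nonempty_Icc.2 hW) hcont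
  have hp1 : h2 p < 1 := by
    rw [← h2_half]; exact h2_strictMonoOn ⟨hp₀, hp.le⟩ ⟨by norm_num, le_rfl⟩ hp
  have pos_slope : ∀ ω ∈ Set.Icc W (1 / 2), 0 < sl ω → p < ω := by
    intro ω hω hs
    by_contra hle
    have h0 : 0 < ω := hW₀.trans_le hω.1
    have := h2_strictMonoOn.monotoneOn ⟨h0.le, hω.2⟩ ⟨hp₀, hp.le⟩ (not_lt.1 hle)
    exact absurd hs (not_lt.2 (div_nonpos_of_nonpos_of_nonneg (by linarith) h0.le))
  have hs_pos : 0 < sl ω := by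
    refine lt_of_lt_of_le ?_ (hmax ⟨hW, le_rfl⟩ : sl (1 / 2) ≤ sl ω)
    simp only [hsl, h2_half]
    apply div_pos <;> linarith
  have hhp : 0 ≤ h2 p := h2_nonneg hp₀ (by linarith)
  set T := insert ((0 : ℝ), (0 : ℝ))
    ((fun w : ℝ => (w, h2 w - h2 p)) '' Set.Icc (0 : ℝ) (1 / 2)) with hT
  have hmem : ∀ ω ∈ Set.Icc W (1 / 2), (W, W * sl ω) ∈ convexHull ℝ T := by
    intro ω hω
    have h0 : 0 < ω := hW₀.trans_le hω.1
    have h₁ : ((0 : ℝ), (0 : ℝ)) ∈ convexHull ℝ T := subset_convexHull ℝ T (Set.mem_insert _ _)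
    have h₂ : (ω, h2 ω - h2 p) ∈ convexHull ℝ T :=
      subset_convexHull ℝ T (Set.mem_insert_of_mem _ ⟨ω, ⟨h0.le, hω.2⟩, rfl⟩)
    have := (convex_convexHull ℝ T) h₁ h₂ (a := 1 - W / ω) (b := W / ω)
      (sub_nonneg.2 ((div_le_one h0).2 hω.1)) (by positivity) (by ring)
    convert this using 1
    ext
    · simp; field_simp
    · simp [hsl]; field_simp
  have hgreatest : IsGreatest {y : ℝ | (W, y) ∈ convexHull ℝ T} (W * sl ω) := by
    refine ⟨hmem ω hω, fun y hy => ?_⟩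
    -- If no point to the left of `W` has a steeper chord, the line of slope `sl ω` through the
    -- origin lies above everything.
    by_cases hA : ∀ w ∈ Set.Ioo 0 W, sl w ≤ sl ω
    · have := snd_le_of_mem_convexHull (c := 0) (d := sl ω) ?_ hy
      · simpa [mul_comm] using this
      · rintro q (rfl | ⟨w, hw, rfl⟩)
        · simp
        · simp only [zero_add]
          rcases hw.1.eq_or_lt with rfl | hw0
          · simpa using hhp
          · have : sl w ≤ sl ω := by
              rcases lt_or_ge w W with h | h
              · exact hA w ⟨hw0, h⟩
              · exact hmax ⟨h, hw.2⟩
            rwa [hsl, div_le_iff₀ hw0] at this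
    -- Otherwise some `w₀ < W` has a steeper chord than `W` itself. The tangent at `W` then passes
    -- on or above the origin, so it dominates the whole set and the bound at `W` is the curve
    -- value, at most `W * sl ω`.
    · push Not at hA
      obtain ⟨w₀, hw₀, hlt⟩ := hA
      obtain ⟨d, hd⟩ := h2_le_tangent hW₀ (by linarith)
      have hWs : sl W ≤ sl ω := hmax ⟨le_rfl, hW⟩
      have hsW : sl W * W = h2 W - h2 p := by simp only [hsl]; field_simp
      have hs0 : sl w₀ * w₀ = h2 w₀ - h2 p := by
        have := hw₀.1.ne'
        simp only [hsl]; field_simp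
      have hdW : d * W ≤ h2 W - h2 p := by
        have h₁ := hd w₀ ⟨hw₀.1.le, by linarith [hw₀.2]⟩
        have h₂ : sl W * w₀ ≤ sl w₀ * w₀ :=
          mul_le_mul_of_nonneg_right (by linarith) hw₀.1.le
        have h₃ : d * (W - w₀) ≤ sl W * (W - w₀) := by nlinarith
        have h₄ : d ≤ sl W := le_of_mul_le_mul_right h₃ (by linarith [hw₀.2])
        nlinarith
      have := snd_le_of_mem_convexHull (c := h2 W - h2 p - d * W) (d := d) ?_ hy
      · simp only at this
        nlinarith
      · rintro q (rfl | ⟨w, hw, rfl⟩)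
        · simpa using hdW
        · have := hd w ⟨hw.1, by linarith [hw.2]⟩
          simp only
          linarith
  have hR : RGP W p = W * sl ω := hgreatest.csSup_eq
  -- When the curve already meets the envelope at `W`, the point `W` is itself a maximiser and
  -- replaces `ω`.
  by_cases hE : RGP W p = h2 W - h2 p
  · have hsW : sl W = sl ω := by
      have : W * sl ω = W * sl W := by
        rw [← hR, hE]; simp only [hsl]; field_simp
      exact (mul_left_cancel₀ hW₀.ne' this).symm
    exact ⟨W, pos_slope W ⟨le_rfl, hW⟩ (hsW ▸ hs_pos), le_rfl, hW, fun _ => rfl, by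
      rw [hE, div_self hW₀.ne', one_mul]⟩
  · exact ⟨ω, pos_slope ω hω hs_pos, hω.1, hω.2, fun h => absurd h hE, by
      rw [hR]; simp only [hsl]; ring⟩

/-! ### Concentration of the weight of the noise -/

theorem sum_word_succ {N : ℕ} (H : Word (N + 1) → ℝ) :
    ∑ z, H z = ∑ x : Word N, H (Fin.cons 0 x) + ∑ x : Word N, H (Fin.cons 1 x) := by
  rw [← (Fin.consEquiv fun _ : Fin (N + 1) => ZMod 2).sum_comp, Fintype.sum_prod_type]
  have : (Finset.univ : Finset (ZMod 2)) = {0, 1} := rfl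
  rw [this, Finset.sum_pair (by decide)]
  rfl

theorem hammingNorm_cons {N : ℕ} (b : ZMod 2) (x : Word N) :
    hammingNorm (Fin.cons b x : Word (N + 1)) = (if b = 0 then 0 else 1) + hammingNorm x := by
  simp [hammingNorm_eq_sum, Fin.sum_univ_succ]

theorem noiseProb_cons (p : ℝ) {N : ℕ} (b : ZMod 2) (x : Word N) :
    noiseProb p (Fin.cons b x : Word (N + 1)) = (if b = 0 then 1 - p else p) * noiseProb p x := by
  simp [noiseProb, Fin.prod_univ_succ]

theorem noiseProb_eq_pow (p : ℝ) {N : ℕ} (z : Word N) :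
    noiseProb p z = p ^ hammingNorm z * (1 - p) ^ (N - hammingNorm z) := by
  have h := Finset.card_filter_add_card_filter_not (s := Finset.univ) (fun i : Fin N => z i = 0)
  have hw : hammingNorm z = (Finset.univ.filter fun i : Fin N => ¬ z i = 0).card := rfl
  rw [noiseProb, Finset.prod_ite, Finset.prod_const, Finset.prod_const, hw, mul_comm]
  congr 2
  rw [Finset.card_univ, Fintype.card_fin] at h
  omega

/-- Mean and variance of a sum of independent bits, by splitting off one coordinate. The mixed term
in the variance cancels because a single bit is centred at `p`. -/
theorem noise_moments (p : ℝ) (N : ℕ) :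
    ∑ z : Word N, noiseProb p z * ((hammingNorm z : ℝ) - p * N) = 0 ∧
      ∑ z : Word N, noiseProb p z * ((hammingNorm z : ℝ) - p * N) ^ 2 = N * p * (1 - p) := by
  induction N with
  | zero => simp [hammingNorm_eq_sum]
  | succ N ih =>
    obtain ⟨h₁, h₂⟩ := ih
    have h₀ := sum_noiseProb p N
    constructor
    · rw [sum_word_succ]
      simp only [hammingNorm_cons, noiseProb_cons]
      calc _ = ∑ z : Word N, noiseProb p z * ((hammingNorm z : ℝ) - p * N) := by
            rw [← Finset.sum_add_distrib]
            refine Finset.sum_congr rfl fun z _ => ?_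
            simp; ring
        _ = 0 := h₁
    · rw [sum_word_succ]
      simp only [hammingNorm_cons, noiseProb_cons]
      calc _ = ∑ z : Word N, noiseProb p z * ((hammingNorm z : ℝ) - p * N) ^ 2
            + (p * (1 - p)) * ∑ z : Word N, noiseProb p z := by
            rw [← Finset.sum_add_distrib, Finset.mul_sum, ← Finset.sum_add_distrib]
            refine Finset.sum_congr rfl fun z _ => ?_
            simp; ring
        _ = _ := by rw [h₂, h₀]; push_cast; ring

/-- Chebyshev's inequality for the weight of the noise. -/
theorem noise_tail {p t : ℝ} (hp₀ : 0 ≤ p) (hp₁ : p ≤ 1) (ht : 0 < t) (N : ℕ) :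
    ∑ z : Word N, (if t ≤ |(hammingNorm z : ℝ) - p * N| then noiseProb p z else 0) ≤ N / t ^ 2 := by
  rw [le_div_iff₀ (by positivity), Finset.sum_mul]
  calc _ ≤ ∑ z : Word N, noiseProb p z * ((hammingNorm z : ℝ) - p * N) ^ 2 := by
        refine Finset.sum_le_sum fun z _ => ?_
        have := noiseProb_nonneg hp₀ hp₁ z
        split_ifs with h
        · refine mul_le_mul_of_nonneg_left ?_ this
          rw [← sq_abs ((hammingNorm z : ℝ) - p * N)]
          gcongr
        · rw [zero_mul]; positivity
    _ = N * (p * (1 - p)) := by rw [(noise_moments p N).2]; ring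
    _ ≤ N * 1 := by gcongr; nlinarith
    _ = N := mul_one _

/-! ### Hamming balls -/

/-- The number of words of length `N` and weight at most `d`. -/
def ballCard (N d : ℕ) : ℕ := (Finset.univ.filter fun x : Word N => hammingNorm x ≤ d).card

theorem ballCard_pos (N d : ℕ) : 0 < ballCard N d :=
  Finset.card_pos.2 ⟨0, by simp⟩

theorem ballCard_zero (N : ℕ) : ballCard N 0 = 1 := by
  rw [ballCard, Finset.card_eq_one]
  exact ⟨0, by ext; simp⟩

theorem mul_h2_div {N d : ℕ} (hN : 0 < N) :
    (N : ℝ) * Real.binEntropy (d / N) =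
      -(d * Real.log (d / N) + ((N : ℝ) - d) * Real.log (1 - d / N)) := by
  have : (N : ℝ) ≠ 0 := by positivity
  rw [Real.binEntropy_eq_negMulLog_add_negMulLog_one_sub, Real.negMulLog, Real.negMulLog]
  field_simp
  ring

/-- Under Bernoulli noise of parameter `q = d / N ≤ 1/2`, lighter words are more likely. Every word
of the ball therefore has probability at least `q ^ d (1 - q) ^ (N - d)`, and the total is at most
one. -/
theorem log_ballCard_le {N d : ℕ} (hd : 2 * d ≤ N) :
    Real.log (ballCard N d) ≤ N * Real.binEntropy (d / N) := by
  rcases Nat.eq_zero_or_pos d with rfl | hd0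
  · simp [ballCard_zero]
  have hN : 0 < N := by omega
  have hN' : (0 : ℝ) < N := by exact_mod_cast hN
  set q : ℝ := d / N with hq
  have hd0' : (0 : ℝ) < d := by exact_mod_cast hd0
  have q0 : 0 < q := by positivity
  have q1 : q ≤ 1 - q := by
    have : (2 : ℝ) * d ≤ N := by exact_mod_cast hd
    have : q ≤ 1 / 2 := by rw [hq, div_le_div_iff₀ hN' two_pos]; linarith
    linarith
  have key : (ballCard N d : ℝ) * (q ^ d * (1 - q) ^ (N - d)) ≤ 1 := by
    rw [ballCard, ← nsmul_eq_mul, ← Finset.sum_const]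
    refine le_of_le_of_eq ?_ (sum_noiseProb q N)
    refine (Finset.sum_le_sum fun z hz => ?_).trans
      (Finset.sum_le_univ_sum_of_nonneg fun z => noiseProb_nonneg q0.le (by linarith) z)
    have hz' : hammingNorm z ≤ d := (Finset.mem_filter.1 hz).2
    rw [noiseProb_eq_pow]
    calc q ^ d * (1 - q) ^ (N - d)
        = q ^ hammingNorm z * (q ^ (d - hammingNorm z) * (1 - q) ^ (N - d)) := by
          rw [← mul_assoc, ← pow_add]; congr 2; omega
      _ ≤ q ^ hammingNorm z * ((1 - q) ^ (d - hammingNorm z) * (1 - q) ^ (N - d)) := by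
          have : 0 ≤ 1 - q := by linarith
          gcongr
      _ = _ := by rw [← pow_add]; congr 2; omega
  have hb : (0 : ℝ) < ballCard N d := by exact_mod_cast ballCard_pos N d
  have q1' : 0 < 1 - q := by linarith
  have := Real.log_nonpos (by positivity) key
  rw [Real.log_mul hb.ne' (by positivity), Real.log_mul (by positivity) (by positivity),
    Real.log_pow, Real.log_pow, Nat.cast_sub (by omega)] at this
  rw [mul_h2_div hN]
  linarith

/-- Typical words, of weight within `δ N` of `q N`, carry at least half of the Bernoulli mass by
Chebyshev. Each has probability at most `B`, and all lie in the ball, so the ball has at least `1 /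
(2 B)` elements. -/
theorem le_log_ballCard {N d : ℕ} {q δ : ℝ} (q0 : 0 < q) (q1 : q ≤ 1 / 2) (hδ : 0 < δ)
    (hN : 2 ≤ N * δ ^ 2) (hd : (q + δ) * N ≤ d) :
    N * (Real.binEntropy q - δ * (Real.log (1 - q) - Real.log q)) - Real.log 2
      ≤ Real.log (ballCard N d) := by
  have hN0 : (0 : ℝ) < N := by
    by_contra h
    have : (N : ℝ) = 0 := le_antisymm (not_lt.1 h) (by positivity)
    rw [this] at hN; linarith
  have q1' : 0 < 1 - q := by linarith
  set B : ℝ := Real.exp (-(N * (Real.binEntropy q - δ * (Real.log (1 - q) - Real.log q)))) with hB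
  have hlog : 0 ≤ Real.log (1 - q) - Real.log q :=
    sub_nonneg.2 (Real.log_le_log q0 (by linarith))
  have typ : ∀ z : Word N, ¬ δ * N ≤ |(hammingNorm z : ℝ) - q * N| → noiseProb q z ≤ B := by
    intro z hz
    have hw : hammingNorm z ≤ N := by simpa using hammingNorm_le_card_fintype (x := z)
    rw [noiseProb_eq_pow, hB, ← Real.log_le_iff_le_exp (by positivity),
      Real.log_mul (by positivity) (by positivity), Real.log_pow, Real.log_pow, Nat.cast_sub hw,
      Real.binEntropy_eq_negMulLog_add_negMulLog_one_sub, Real.negMulLog, Real.negMulLog]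
    have h₁ := (abs_lt.1 (not_le.1 hz)).1
    nlinarith
  have tail := noise_tail q0.le (by linarith) (mul_pos hδ hN0) N
  have hhalf : (N : ℝ) / (δ * N) ^ 2 ≤ 1 / 2 := by
    rw [div_le_div_iff₀ (by positivity) two_pos]
    nlinarith
  have key : (1 : ℝ) / 2 ≤ ballCard N d * B := by
    have h₁ : (1 : ℝ) ≤ ∑ z : Word N,
        ((if δ * N ≤ |(hammingNorm z : ℝ) - q * N| then noiseProb q z else 0) +
          if hammingNorm z ≤ d then B else 0) := by
      rw [← sum_noiseProb q N]
      refine Finset.sum_le_sum fun z _ => ?_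
      by_cases hz : δ * N ≤ |(hammingNorm z : ℝ) - q * N|
      · rw [if_pos hz]
        refine le_add_of_nonneg_right ?_
        split_ifs <;> positivity
      · rw [if_neg hz, zero_add, if_pos]
        · exact typ z hz
        · have := (abs_lt.1 (not_le.1 hz)).2
          have : (hammingNorm z : ℝ) ≤ d := by linarith
          exact_mod_cast this
    rw [Finset.sum_add_distrib, ← Finset.sum_filter (fun z : Word N => hammingNorm z ≤ d),
      Finset.sum_const, nsmul_eq_mul] at h₁
    rw [ballCard]
    linarith
  have hb : (0 : ℝ) < ballCard N d := by exact_mod_cast ballCard_pos N d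
  have := Real.log_le_log (by norm_num) key
  rw [Real.log_mul hb.ne' (by positivity), hB, Real.log_exp, one_div, Real.log_inv] at this
  linarith

/-- The exponential growth rate of Hamming balls. -/
theorem tendsto_logb_ballCard {N d : ℕ → ℕ} {ρ : ℝ} (hN : Tendsto N atTop atTop)
    (hd : Tendsto (fun i => (d i : ℝ) / N i) atTop (𝓝 ρ)) (hdN : ∀ᶠ i in atTop, 2 * d i ≤ N i) :
    Tendsto (fun i => Real.logb 2 (ballCard (N i) (d i)) / N i) atTop (𝓝 (h2 ρ)) := by
  have hρ₀ : 0 ≤ ρ := ge_of_tendsto' hd fun i => by positivity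
  have hρ₁ : ρ ≤ 1 / 2 := by
    refine le_of_tendsto hd ?_
    filter_upwards [hdN, hN.eventually_gt_atTop 0] with i hi h0
    have h0' : (0 : ℝ) < N i := by exact_mod_cast h0
    rw [div_le_div_iff₀ h0' two_pos]
    have : (2 : ℝ) * d i ≤ N i := by exact_mod_cast hi
    linarith
  have hNr : Tendsto (fun i => (N i : ℝ)) atTop atTop := tendsto_natCast_atTop_atTop.comp hN
  rw [tendsto_order]
  constructor
  · intro c hc
    rcases hρ₀.eq_or_lt with rfl | hρ
    · rw [h2_zero] at hc
      refine Eventually.of_forall fun i => hc.trans_le ?_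
      have : (1 : ℝ) ≤ ballCard (N i) (d i) := by exact_mod_cast ballCard_pos _ _
      exact div_nonneg (Real.logb_nonneg one_lt_two this) (by positivity)
    -- Typical words for a parameter `q` slightly below `ρ`, with `δ < ρ - q`, eventually lie in the
    -- ball. The loss `δ L` is made small by shrinking `δ` after `q` is fixed.
    · have e₁ : ∀ᶠ q in 𝓝[<] ρ, c < h2 q :=
        nhdsWithin_le_nhds (continuous_h2.continuousAt.eventually_const_lt hc)
      have e₂ : ∀ᶠ q in 𝓝[<] ρ, q ∈ Set.Ioo 0 ρ := Ioo_mem_nhdsLT hρ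
      obtain ⟨q, hq, q0, q1⟩ := (e₁.and e₂).exists
      set L := (Real.log (1 - q) - Real.log q) / Real.log 2 with hL
      have t : Tendsto (fun δ : ℝ => h2 q - δ * L) (𝓝[>] 0) (𝓝 (h2 q - 0 * L)) := by
        refine Tendsto.mono_left ?_ nhdsWithin_le_nhds
        exact (continuous_const.sub (continuous_id.mul continuous_const)).tendsto 0
      have e₃ := t.eventually_const_lt (u := c) (by simpa using hq)
      have e₄ : ∀ᶠ δ in 𝓝[>] (0 : ℝ), δ ∈ Set.Ioo 0 (ρ - q) := Ioo_mem_nhdsGT (sub_pos.2 q1)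
      obtain ⟨δ, hδ, δ0, δ1⟩ := (e₃.and e₄).exists
      have e₅ : ∀ᶠ i in atTop, q + δ < (d i : ℝ) / N i := hd.eventually_const_lt (by linarith)
      have e₆ : ∀ᶠ i in atTop, c < h2 q - δ * L - 1 / (N i : ℝ) := by
        have := (tendsto_const_nhds (x := h2 q - δ * L)).sub
          (tendsto_const_nhds (x := (1 : ℝ)).div_atTop hNr)
        exact this.eventually_const_lt (by simpa using hδ)
      have e₇ : ∀ᶠ i in atTop, 2 ≤ N i * δ ^ 2 :=
        (hNr.atTop_mul_const (by positivity)).eventually_ge_atTop 2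
      filter_upwards [e₅, e₆, e₇, hN.eventually_gt_atTop 0] with i h₅ h₆ h₇ h₀
      have h0' : (0 : ℝ) < N i := by exact_mod_cast h₀
      refine h₆.trans_le ?_
      have := le_log_ballCard q0 (by linarith) δ0 h₇ ((lt_div_iff₀ h0').1 h₅).le
      rw [le_div_iff₀ h0', Real.logb, le_div_iff₀ log_two_pos]
      refine le_trans (le_of_eq ?_) this
      have := log_two_pos.ne'
      rw [hL, h2]
      field_simp
  · intro c hc
    have : Tendsto (fun i => h2 ((d i : ℝ) / N i)) atTop (𝓝 (h2 ρ)) :=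
      (continuous_h2.tendsto ρ).comp hd
    filter_upwards [this.eventually_lt_const hc, hdN, hN.eventually_gt_atTop 0] with i h₁ h₂ h₀
    have h0' : (0 : ℝ) < N i := by exact_mod_cast h₀
    refine lt_of_le_of_lt ?_ h₁
    rw [div_le_iff₀ h0', Real.logb, div_le_iff₀ log_two_pos, h2]
    refine (log_ballCard_le h₂).trans_eq ?_
    have := log_two_pos.ne'
    field_simp

/-! ### Random linear maps -/

/-- All fibres of a surjective homomorphism have the same size, so it carries the uniform
distribution to the uniform distribution. Applied to evaluation maps on the group of linear maps,
this supplies all the randomness needed. -/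
theorem sum_comp_of_surjective {G K : Type*} [AddGroup G] [Fintype G] [AddGroup K] [Fintype K]
    (f : G →+ K) (hf : Function.Surjective f) (F : K → ℝ) :
    (∑ g, F (f g)) * Fintype.card K = Fintype.card G * ∑ y, F y := by
  classical
  have hfib : ∀ y, (Finset.univ.filter fun g => f g = y).card
      = (Finset.univ.filter fun g => f g = 0).card := fun y =>
    AddMonoidHom.card_fiber_eq_of_mem_range f (hf y) (hf 0)
  have h : ∀ F : K → ℝ, ∑ g, F (f g)
      = (Finset.univ.filter fun g => f g = 0).card * ∑ y, F y := by
    intro F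
    rw [← Finset.sum_fiberwise Finset.univ f, Finset.mul_sum]
    refine Finset.sum_congr rfl fun y _ => ?_
    rw [← hfib y, ← nsmul_eq_mul, ← Finset.sum_const]
    exact Finset.sum_congr rfl fun g hg => by rw [(Finset.mem_filter.1 hg).2]
  have h₁ := h fun _ => 1
  simp only [Finset.sum_const, nsmul_eq_mul, mul_one, Finset.card_univ] at h₁
  rw [h F, h₁]
  ring

/-- The indicator function of the Hamming ball around the origin. -/
def ballInd {N : ℕ} (d : ℕ) (x : Word N) : ℝ := if hammingNorm x ≤ d then 1 else 0

theorem ballInd_nonneg {N : ℕ} (d : ℕ) (x : Word N) : 0 ≤ ballInd d x := by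
  unfold ballInd; split_ifs <;> norm_num

theorem sum_ballInd (N d : ℕ) : ∑ x : Word N, ballInd d x = ballCard N d := by
  simp [ballInd, ballCard, Finset.sum_boole]

theorem sum_ballInd_sub {N : ℕ} (d : ℕ) (y : Word N) :
    ∑ x : Word N, ballInd d (x - y) = ballCard N d := by
  rw [← sum_ballInd N d]
  exact (Equiv.subRight y).sum_comp _

theorem sum_ballInd_sub' {N : ℕ} (d : ℕ) (y : Word N) :
    ∑ x : Word N, ballInd d (y - x) = ballCard N d := by
  rw [← sum_ballInd N d]
  exact (Equiv.subLeft y).sum_comp _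

theorem sum_ballInd_add {N : ℕ} (d : ℕ) (y : Word N) :
    ∑ x : Word N, ballInd d (y + x) = ballCard N d := by
  rw [← sum_ballInd N d]
  exact (Equiv.addLeft y).bijective.sum_comp (ballInd d)

section RandomMap

variable {E : Type*} [AddCommGroup E] [Module (ZMod 2) E] {N : ℕ}

open Classical in
/-- The indicator of the event that `x` has distance larger than `d` from all words `A u`,
`u ∈ T`. -/
noncomputable def uncoveredInd (T : Finset E) (d : ℕ) (A : E →ₗ[ZMod 2] Word N) (x : Word N) : ℝ :=
  if ∀ u ∈ T, ¬ hammingNorm (x - A u) ≤ d then 1 else 0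

open Classical in
/-- The indicator of the event that `u` is a linearly independent tuple in `T` whose image under
`A` lies in the ball of radius `d` around `x`. -/
noncomputable def tupleInd (T : Finset E) (d : ℕ) {t : ℕ} (A : E →ₗ[ZMod 2] Word N) (x : Word N)
    (u : Fin t → E) : ℝ :=
  if (∀ i, u i ∈ T) ∧ LinearIndependent (ZMod 2) u then ∏ i, ballInd d (x - A (u i)) else 0

theorem uncoveredInd_nonneg (T : Finset E) (d : ℕ) (A : E →ₗ[ZMod 2] Word N) (x : Word N) :
    0 ≤ uncoveredInd T d A x := by
  unfold uncoveredInd; split_ifs <;> norm_num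

theorem tupleInd_nonneg (T : Finset E) (d : ℕ) {t : ℕ} (A : E →ₗ[ZMod 2] Word N) (x : Word N)
    (u : Fin t → E) : 0 ≤ tupleInd T d A x u := by
  unfold tupleInd
  split_ifs
  · exact Finset.prod_nonneg fun j _ => ballInd_nonneg _ _
  · exact le_rfl

/-- The number of linearly independent `t`-tuples in `T` whose images lie in some ball of radius
`d`, counted with the centres of the balls. -/
noncomputable def tupleCount [Fintype E] (T : Finset E) (d t : ℕ) (A : E →ₗ[ZMod 2] Word N) : ℝ :=
  ∑ x : Word N, ∑ u : Fin t → E, tupleInd T d A x u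

theorem tupleCount_nonneg [Fintype E] (T : Finset E) (d t : ℕ) (A : E →ₗ[ZMod 2] Word N) :
    0 ≤ tupleCount T d t A :=
  Finset.sum_nonneg fun x _ => Finset.sum_nonneg fun u _ => tupleInd_nonneg T d A x u

theorem one_le_tupleCount [Fintype E] {T : Finset E} {d t : ℕ} {A : E →ₗ[ZMod 2] Word N}
    {x : Word N} {u : Fin t → E} (hu : ∀ i, u i ∈ T) (hlin : LinearIndependent (ZMod 2) u)
    (hd : ∀ i, hammingNorm (x - A (u i)) ≤ d) : 1 ≤ tupleCount T d t A := by
  calc (1 : ℝ) = tupleInd T d A x u := by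
        rw [tupleInd, if_pos ⟨hu, hlin⟩]
        exact (Finset.prod_eq_one fun j _ => if_pos (hd j)).symm
    _ ≤ ∑ u : Fin t → E, tupleInd T d A x u :=
      Finset.single_le_sum (fun u _ => tupleInd_nonneg T d A x u) (Finset.mem_univ u)
    _ ≤ tupleCount T d t A :=
      Finset.single_le_sum (f := fun x => ∑ u : Fin t → E, tupleInd T d A x u)
        (fun x _ => Finset.sum_nonneg fun u _ => tupleInd_nonneg T d A x u) (Finset.mem_univ x)

theorem exists_linearMap_eq {ι : Type*} [Fintype ι] {u : ι → E} (hu : LinearIndependent (ZMod 2) u)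
    (w : ι → Word N) : ∃ A : E →ₗ[ZMod 2] Word N, ∀ i, A (u i) = w i := by
  classical
  obtain ⟨l, hl⟩ := LinearMap.exists_leftInverse_of_injective
    (Fintype.linearCombination (ZMod 2) u)
    (LinearMap.ker_eq_bot.2 hu.fintypeLinearCombination_injective)
  refine ⟨Fintype.linearCombination (ZMod 2) w ∘ₗ l, fun i => ?_⟩
  have : l (u i) = Pi.single i 1 := by
    have := LinearMap.congr_fun hl (Pi.single i 1)
    simpa [Fintype.linearCombination_apply_single] using this
  simp [this, Fintype.linearCombination_apply_single]

variable [Fintype (E →ₗ[ZMod 2] Word N)]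

/-- The images of linearly independent vectors under a uniform linear map are independent and
uniform. -/
theorem sum_linearMap_tuple {ι : Type*} [Fintype ι] [DecidableEq ι] {u : ι → E}
    (hu : LinearIndependent (ZMod 2) u) (F : (ι → Word N) → ℝ) :
    (∑ A : E →ₗ[ZMod 2] Word N, F fun i => A (u i)) * (2 ^ N) ^ Fintype.card ι
      = Fintype.card (E →ₗ[ZMod 2] Word N) * ∑ w, F w := by
  have := sum_comp_of_surjective
    (AddMonoidHom.mk' (fun (A : E →ₗ[ZMod 2] Word N) (i : ι) => A (u i)) fun A B => rfl)
    (fun w => by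
      obtain ⟨A, hA⟩ := exists_linearMap_eq hu w
      exact ⟨A, funext hA⟩) F
  rw [← this]
  congr 1
  rw [Fintype.card_fun, card_word]
  push_cast
  rfl

theorem sum_linearMap {u : E} (hu : u ≠ 0) (F : Word N → ℝ) :
    (∑ A : E →ₗ[ZMod 2] Word N, F (A u)) * 2 ^ N
      = Fintype.card (E →ₗ[ZMod 2] Word N) * ∑ w, F w := by
  have := sum_comp_of_surjective
    (AddMonoidHom.mk' (fun (A : E →ₗ[ZMod 2] Word N) => A u) fun A B => rfl)
    (fun w => by
      obtain ⟨A, hA⟩ := exists_linearMap_eq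
        ((linearIndependent_unique_iff (v := fun _ : Unit => u)).2 hu) fun _ => w
      exact ⟨A, hA ()⟩) F
  rw [← this, card_word]
  push_cast
  rfl

theorem sum_linearMap_finset {T : Finset E} (hT : ∀ u ∈ T, u ≠ 0) (F : Word N → ℝ) :
    (∑ A : E →ₗ[ZMod 2] Word N, ∑ u ∈ T, F (A u)) * 2 ^ N
      = Fintype.card (E →ₗ[ZMod 2] Word N) * (T.card * ∑ w, F w) := by
  rw [Finset.sum_comm, Finset.sum_mul, Finset.sum_congr rfl fun u hu => sum_linearMap (hT u hu) F,
    Finset.sum_const, nsmul_eq_mul]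
  ring

/-- Summing over the centre `x` permits recentring at `A u`, after which only `A (u - u')` matters.
It is uniform because `u - u' ≠ 0`, so even `u = 0` is allowed. -/
theorem sum_ballInd_mul {u u' : E} (h : u ≠ u') (d : ℕ) :
    (∑ A : E →ₗ[ZMod 2] Word N, ∑ x, ballInd d (x - A u) * ballInd d (x - A u')) * 2 ^ N
      = Fintype.card (E →ₗ[ZMod 2] Word N) * (ballCard N d : ℝ) ^ 2 := by
  have h₁ : ∀ A : E →ₗ[ZMod 2] Word N, ∑ x, ballInd d (x - A u) * ballInd d (x - A u')
      = ∑ x, ballInd d x * ballInd d (x + A (u - u')) := by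
    intro A
    rw [← Function.Bijective.sum_comp (Equiv.addRight (A u)).bijective
      fun x => ballInd d (x - A u) * ballInd d (x - A u')]
    refine Finset.sum_congr rfl fun x _ => ?_
    simp only [Equiv.coe_addRight, add_sub_cancel_right, map_sub, add_sub_assoc]
  simp_rw [h₁]
  rw [sum_linearMap (sub_ne_zero.2 h) fun w => ∑ x, ballInd d x * ballInd d (x + w),
    Finset.sum_comm]
  simp_rw [← Finset.mul_sum, sum_ballInd_add, ← Finset.sum_mul, sum_ballInd, sq]

/-- Second moment bound: a random linear code covers most words. -/
theorem sum_uncovered_le (T : Finset E) (d : ℕ) :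
    (∑ A : E →ₗ[ZMod 2] Word N, ∑ x : Word N, uncoveredInd T d A x) * (T.card * ballCard N d)
      ≤ Fintype.card (E →ₗ[ZMod 2] Word N) * (2 ^ N * 2 ^ N) := by
  classical
  set H : ℝ := (Fintype.card (E →ₗ[ZMod 2] Word N) : ℝ) with hH
  rcases T.eq_empty_or_nonempty with rfl | hne
  · simp only [Finset.card_empty, Nat.cast_zero, zero_mul, mul_zero]; positivity
  set B : ℝ := (ballCard N d : ℝ) with hB
  set c : ℝ := (T.card : ℝ) with hc
  have hB0 : 0 < B := by exact Nat.cast_pos.2 (ballCard_pos N d)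
  have hc0 : 0 < c := by exact Nat.cast_pos.2 (Finset.card_pos.2 hne)
  set M : ℝ := 2 ^ N with hM
  have hM0 : 0 < M := by positivity
  set Z : (E →ₗ[ZMod 2] Word N) → Word N → ℝ := fun A x => ∑ u ∈ T, ballInd d (x - A u) with hZ
  set μ : ℝ := c * B / M with hμ
  have hμ0 : 0 < μ := by positivity
  have first : ∑ A, ∑ x, Z A x = H * (c * B) := by
    have : ∀ A, ∑ x, Z A x = c * B := by
      intro A
      rw [hZ, Finset.sum_comm, Finset.sum_congr rfl fun u _ => sum_ballInd_sub d (A u),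
        Finset.sum_const, nsmul_eq_mul]
    simp_rw [this, Finset.sum_const, nsmul_eq_mul, Finset.card_univ, hH]
  have second : ∑ A, ∑ x, Z A x ^ 2 ≤ H * (c * B) + H * (c * B) ^ 2 / M := by
    have e : ∑ A, ∑ x, Z A x ^ 2 = ∑ u ∈ T, ∑ u' ∈ T, ∑ A : E →ₗ[ZMod 2] Word N, ∑ x,
        ballInd d (x - A u) * ballInd d (x - A u') := by
      simp_rw [hZ, sq, Finset.sum_mul_sum]
      rw [Finset.sum_congr rfl fun A _ => Finset.sum_comm, Finset.sum_comm]
      refine Finset.sum_congr rfl fun u _ => ?_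
      rw [Finset.sum_congr rfl fun A _ => Finset.sum_comm, Finset.sum_comm]
    have b : ∀ u ∈ T, ∀ u' ∈ T, ∑ A : E →ₗ[ZMod 2] Word N, ∑ x,
        ballInd d (x - A u) * ballInd d (x - A u') ≤
          (if u = u' then H * B else 0) + H * B ^ 2 / M := by
      intro u _ u' _
      split_ifs with h
      · subst h
        have : ∀ A : E →ₗ[ZMod 2] Word N, ∑ x, ballInd d (x - A u) * ballInd d (x - A u) = B := by
          intro A
          rw [hB, ← sum_ballInd_sub d (A u)]
          refine Finset.sum_congr rfl fun x _ => ?_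
          unfold ballInd; split_ifs <;> norm_num
        simp_rw [this, Finset.sum_const, nsmul_eq_mul, Finset.card_univ]
        refine le_add_of_nonneg_right ?_
        positivity
      · rw [zero_add, ← sum_ballInd_mul h d, mul_div_assoc, div_self hM0.ne', mul_one]
    rw [e]
    refine (Finset.sum_le_sum fun u hu => Finset.sum_le_sum fun u' hu' => b u hu u' hu').trans_eq ?_
    simp only [Finset.sum_add_distrib, Finset.sum_ite_eq, Finset.sum_const, nsmul_eq_mul]
    rw [Finset.sum_congr rfl fun u hu => if_pos hu, Finset.sum_const, nsmul_eq_mul]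
    ring
  -- `Z A x` counts the elements of `T` whose images cover `x`, and `μ` is its mean over `A` and
  -- `x`. Off-diagonal pairs contribute at most `μ ^ 2` on average, so only the diagonal survives.
  have var : ∑ A, ∑ x, (Z A x - μ) ^ 2 ≤ H * (c * B) := by
    have : ∑ A, ∑ x, (Z A x - μ) ^ 2
        = ∑ A, ∑ x, Z A x ^ 2 - 2 * μ * ∑ A, ∑ x, Z A x + H * (M * μ ^ 2) := by
      have hconst : ∑ A : E →ₗ[ZMod 2] Word N, ∑ x : Word N, μ ^ 2 = H * (M * μ ^ 2) := by
        simp only [Finset.sum_const, Finset.card_univ, nsmul_eq_mul, card_word, hH, hM]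
        push_cast
        rfl
      simp_rw [Finset.mul_sum]
      rw [← hconst, ← Finset.sum_sub_distrib, ← Finset.sum_add_distrib]
      refine Finset.sum_congr rfl fun A _ => ?_
      rw [← Finset.sum_sub_distrib, ← Finset.sum_add_distrib]
      exact Finset.sum_congr rfl fun x _ => by ring
    rw [this, first]
    have : H * (M * μ ^ 2) = H * (c * B) ^ 2 / M := by rw [hμ]; field_simp
    have : 2 * μ * (H * (c * B)) = 2 * (H * (c * B) ^ 2 / M) := by rw [hμ]; field_simp
    linarith
  -- An uncovered word has `Z A x = 0`, hence deviates from the mean by exactly `μ`.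
  have cheb : (∑ A : E →ₗ[ZMod 2] Word N, ∑ x : Word N, uncoveredInd T d A x) * μ ^ 2
        ≤ ∑ A, ∑ x, (Z A x - μ) ^ 2 := by
    simp_rw [Finset.sum_mul]
    refine Finset.sum_le_sum fun A _ => Finset.sum_le_sum fun x _ => ?_
    unfold uncoveredInd
    split_ifs with h
    · have : Z A x = 0 := Finset.sum_eq_zero fun u hu => if_neg (h u hu)
      rw [this]; apply le_of_eq; ring
    · rw [zero_mul]; positivity
  have h := cheb.trans var
  have hcB : c * B = μ * M := by rw [hμ]; field_simp
  rw [hcB] at h ⊢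
  have h' : _ * μ ≤ H * M := le_of_mul_le_mul_right (by linarith) hμ0
  calc _ = _ * μ * M := by rw [mul_assoc]
    _ ≤ H * M * M := by gcongr
    _ = _ := by ring

/-- First moment bound for the number of linearly independent tuples in a ball. -/
theorem sum_tuples_le [Fintype E] (T : Finset E) (d t : ℕ) :
    (∑ A : E →ₗ[ZMod 2] Word N, tupleCount T d t A) * (2 ^ N) ^ t
      ≤ Fintype.card (E →ₗ[ZMod 2] Word N) * (2 ^ N * (T.card * ballCard N d) ^ t) := by
  classical
  set H : ℝ := (Fintype.card (E →ₗ[ZMod 2] Word N) : ℝ) with hH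
  unfold tupleCount
  rw [Finset.sum_comm, Finset.sum_mul]
  have hx : ∀ x : Word N, (∑ A : E →ₗ[ZMod 2] Word N, ∑ u : Fin t → E,
        tupleInd T d A x u) * (2 ^ N) ^ t
          ≤ H * (T.card * ballCard N d) ^ t := by
    intro x
    rw [Finset.sum_comm, Finset.sum_mul]
    have hu : ∀ u : Fin t → E, (∑ A : E →ₗ[ZMod 2] Word N, tupleInd T d A x u) * (2 ^ N) ^ t
          ≤ if u ∈ Fintype.piFinset fun _ => T then H * ballCard N d ^ t else 0 := by
      intro u
      by_cases h : (∀ i, u i ∈ T) ∧ LinearIndependent (ZMod 2) u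
      · simp only [tupleInd, if_pos h, if_pos (Fintype.mem_piFinset.2 h.1)]
        have := sum_linearMap_tuple (N := N) h.2 fun w => ∏ i, ballInd d (x - w i)
        rw [Fintype.card_fin] at this
        rw [this, ← Fintype.prod_sum fun (_ : Fin t) (y : Word N) => ballInd d (x - y)]
        simp_rw [sum_ballInd_sub', Finset.prod_const, Finset.card_univ, Fintype.card_fin]
        exact le_rfl
      · simp only [tupleInd, if_neg h, Finset.sum_const_zero, zero_mul]
        split_ifs <;> positivity
    refine (Finset.sum_le_sum fun u _ => hu u).trans_eq ?_
    rw [Finset.sum_ite_mem, Finset.univ_inter, Finset.sum_const, Fintype.card_piFinset]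
    simp only [Finset.prod_const, Finset.card_univ, Fintype.card_fin, nsmul_eq_mul]
    push_cast
    ring
  refine (Finset.sum_le_sum fun x _ => hx x).trans_eq ?_
  rw [Finset.sum_const, Finset.card_univ, card_word, nsmul_eq_mul]
  push_cast
  ring

end RandomMap

/-! ### Random nested linear codes -/

section RandomCode

variable {E : Type*} [AddCommGroup E] [Module (ZMod 2) E] {N : ℕ}

open Classical in
/-- There are linear maps which are injective on `V`, give a covering by the images of `V₂`, have a
small probability of confusing noise with codewords, and for which balls contain few linearly
independent codewords. -/
theorem exists_good_linearMap [Fintype E] (V₂ V : Finset E) {p ε : ℝ} (hp₀ : 0 ≤ p) (hp₁ : p ≤ 1)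
    (hε : 0 < ε) (d₁ d₂ : ℕ)
    (hN : (V.card : ℝ) / 2 ^ N + ((N : ℝ) + 1) ^ 2 / 2 ^ N < 1 / 2)
    (hsrc : (2 : ℝ) ^ N ≤ ε * (V₂.card * ballCard N d₁))
    (hchan : (V.card : ℝ) * ballCard N d₂ ≤ ε * 2 ^ N) :
    ∃ A : E →ₗ[ZMod 2] Word N,
      (∀ u ∈ V, u ≠ 0 → A u ≠ 0) ∧
      (∑ x : Word N, uncoveredInd V₂ d₁ A x) ≤ 4 * ε * 2 ^ N ∧
      (∑ u ∈ V.erase 0, ∑ z : Word N, noiseProb p z * ballInd d₂ (z + A u)) ≤ 4 * ε ∧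
      ∀ d ≤ N, ∀ t ≤ N, (V₂.card * ballCard N d) ^ t * 2 ^ (2 * N) ≤ (2 ^ N) ^ t →
        ∀ (x : Word N) (u : Fin t → E), (∀ i, u i ∈ V₂) → LinearIndependent (ZMod 2) u →
          ∃ i, ¬ hammingNorm (x - A (u i)) ≤ d := by
  have : Finite (E →ₗ[ZMod 2] Word N) := DFunLike.finite _
  let _ : Fintype (E →ₗ[ZMod 2] Word N) := Fintype.ofFinite _
  set H : ℝ := (Fintype.card (E →ₗ[ZMod 2] Word N) : ℝ) with hH
  have hH0 : 0 < H := Nat.cast_pos.2 Fintype.card_pos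
  set M : ℝ := 2 ^ N with hM
  have hM0 : 0 < M := by positivity
  set q₀ : (E →ₗ[ZMod 2] Word N) → ℝ := fun A =>
    ∑ u ∈ V.erase 0, if A u = 0 then (1 : ℝ) else 0 with hq₀
  set q₁ : (E →ₗ[ZMod 2] Word N) → ℝ := fun A =>
    ∑ x : Word N, uncoveredInd V₂ d₁ A x with hq₁
  set q₂ : (E →ₗ[ZMod 2] Word N) → ℝ := fun A =>
    ∑ u ∈ V.erase 0, ∑ z : Word N, noiseProb p z * ballInd d₂ (z + A u) with hq₂
  -- All admissible pairs `(d, t)` are treated at once, so that a single code serves every list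
  -- radius. In the condition, one factor `2 ^ N` pays for the choice of the centre and the other
  -- makes each expected count at most `2 ^ (-N)`.
  set I := (Finset.range (N + 1) ×ˢ Finset.range (N + 1)).filter fun i =>
    (V₂.card * ballCard N i.1) ^ i.2 * 2 ^ (2 * N) ≤ (2 ^ N) ^ i.2 with hI
  set q₃ : (E →ₗ[ZMod 2] Word N) → ℝ := fun A => ∑ i ∈ I, tupleCount V₂ i.1 i.2 A with hq₃
  have q₀_nonneg : ∀ A, 0 ≤ q₀ A := fun A =>
    Finset.sum_nonneg fun u _ => by split_ifs <;> norm_num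
  have q₁_nonneg : ∀ A, 0 ≤ q₁ A := fun A =>
    Finset.sum_nonneg fun x _ => uncoveredInd_nonneg _ _ _ _
  have q₂_nonneg : ∀ A, 0 ≤ q₂ A := fun A => Finset.sum_nonneg fun u _ =>
    Finset.sum_nonneg fun z _ => mul_nonneg (noiseProb_nonneg hp₀ hp₁ z) (ballInd_nonneg _ _)
  have q₃_nonneg : ∀ A, 0 ≤ q₃ A := fun A => Finset.sum_nonneg fun i _ =>
    tupleCount_nonneg V₂ i.1 i.2 A
  have le_q₃ : ∀ A, ∀ i ∈ I, tupleCount V₂ i.1 i.2 A ≤ q₃ A := fun A i hi =>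
    Finset.single_le_sum (f := fun i : ℕ × ℕ => tupleCount V₂ i.1 i.2 A)
      (fun i _ => tupleCount_nonneg V₂ i.1 i.2 A) hi
  clear_value I
  have hne : ∀ u ∈ V.erase 0, u ≠ 0 := fun u hu => Finset.ne_of_mem_erase hu
  have b₀ : ∑ A, q₀ A ≤ H * (V.card / M) := by
    have h := sum_linearMap_finset (N := N) (T := V.erase 0) hne
      fun w : Word N => if w = 0 then 1 else 0
    have h1 : ∑ w : Word N, (if w = 0 then (1 : ℝ) else 0) = 1 := by simp
    rw [h1, mul_one] at h
    rw [← mul_div_assoc, le_div_iff₀ hM0]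
    refine h.trans_le ?_
    gcongr
    exact Finset.erase_subset _ _
  have b₁ : ∑ A, q₁ A ≤ H * (ε * M) := by
    have h := sum_uncovered_le (N := N) V₂ d₁
    have h' : (∑ A, q₁ A) * M ≤ H * (ε * M) * M := by
      calc (∑ A, q₁ A) * M ≤ (∑ A, q₁ A) * (ε * (V₂.card * ballCard N d₁)) :=
            mul_le_mul_of_nonneg_left hsrc (Finset.sum_nonneg fun A _ => q₁_nonneg A)
        _ = ε * ((∑ A, q₁ A) * (V₂.card * ballCard N d₁)) := by ring
        _ ≤ ε * (H * (M * M)) := mul_le_mul_of_nonneg_left h hε.le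
        _ = _ := by ring
    exact le_of_mul_le_mul_right h' hM0
  have b₂ : ∑ A, q₂ A ≤ H * ε := by
    have h := sum_linearMap_finset (N := N) (T := V.erase 0) hne
      fun w : Word N => ∑ z : Word N, noiseProb p z * ballInd d₂ (z + w)
    rw [Finset.sum_comm (s := Finset.univ) (t := Finset.univ)] at h
    simp_rw [← Finset.mul_sum, sum_ballInd_add] at h
    rw [← Finset.sum_mul, sum_noiseProb, one_mul] at h
    refine le_of_mul_le_mul_right (h.trans_le ?_) hM0
    rw [mul_assoc]
    refine mul_le_mul_of_nonneg_left (le_trans ?_ hchan) hH0.le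
    gcongr
    exact Finset.erase_subset _ _
  have b₃ : ∑ A, q₃ A ≤ H * (((N : ℝ) + 1) ^ 2 / M) := by
    rw [hq₃, Finset.sum_comm]
    have hi : ∀ i ∈ I, (∑ A : E →ₗ[ZMod 2] Word N, tupleCount V₂ i.1 i.2 A) ≤ H / M := by
      intro i hi
      have hc : ((V₂.card : ℝ) * ballCard N i.1) ^ i.2 * 2 ^ (2 * N) ≤ M ^ i.2 := by
        rw [hM]
        exact_mod_cast (Finset.mem_filter.1 (hI ▸ hi)).2
      have h := sum_tuples_le (N := N) V₂ i.1 i.2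
      have hMi : 0 < M ^ i.2 := by positivity
      refine le_of_mul_le_mul_right (h.trans ?_) hMi
      rw [two_mul, pow_add, ← hM] at hc
      rw [← hH, div_mul_eq_mul_div, le_div_iff₀ hM0, mul_assoc]
      refine mul_le_mul_of_nonneg_left ?_ hH0.le
      calc _ = ((V₂.card : ℝ) * ballCard N i.1) ^ i.2 * (M * M) := by ring
        _ ≤ _ := hc
    refine (Finset.sum_le_sum hi).trans ?_
    rw [Finset.sum_const, nsmul_eq_mul]
    have hcard : (I.card : ℝ) ≤ ((N : ℝ) + 1) ^ 2 := by
      have := Finset.card_filter_le (Finset.range (N + 1) ×ˢ Finset.range (N + 1)) fun i =>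
        (V₂.card * ballCard N i.1) ^ i.2 * 2 ^ (2 * N) ≤ (2 ^ N) ^ i.2
      rw [Finset.card_product, Finset.card_range, ← sq] at this
      rw [hI]
      exact_mod_cast this
    calc (I.card : ℝ) * (H / M) ≤ ((N : ℝ) + 1) ^ 2 * (H / M) := by gcongr
      _ = _ := by ring
  -- The two normalised middle terms average at most `1/4` each, and the outer two together less
  -- than `1/2`. Some map has total below one. For `q₀` and `q₃` this rules out every bad event,
  -- since a single one already contributes at least one.
  obtain ⟨A, -, hA⟩ : ∃ A ∈ (Finset.univ : Finset (E →ₗ[ZMod 2] Word N)),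
      q₀ A + q₁ A / (4 * ε * M) + q₂ A / (4 * ε) + q₃ A < 1 := by
    refine Finset.exists_lt_of_sum_lt ?_
    rw [Finset.sum_const, Finset.card_univ, nsmul_eq_mul, mul_one, ← hH]
    simp_rw [Finset.sum_add_distrib, ← Finset.sum_div]
    have b₁' : (∑ A, q₁ A) / (4 * ε * M) ≤ H * (1 / 4) := by
      rw [div_le_iff₀ (by positivity)]; linarith
    have b₂' : (∑ A, q₂ A) / (4 * ε) ≤ H * (1 / 4) := by
      rw [div_le_iff₀ (by positivity)]; linarith
    have := mul_lt_mul_of_pos_left hN hH0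
    linarith
  have e₁ : 0 ≤ q₁ A / (4 * ε * M) := div_nonneg (q₁_nonneg A) (by positivity)
  have e₂ : 0 ≤ q₂ A / (4 * ε) := div_nonneg (q₂_nonneg A) (by positivity)
  have a₀ := q₀_nonneg A
  have a₃ := q₃_nonneg A
  refine ⟨A, ?_, ?_, ?_, ?_⟩
  · intro u hu hu0 hAu
    have : (1 : ℝ) ≤ q₀ A := by
      have := Finset.single_le_sum (f := fun u => if A u = 0 then (1 : ℝ) else 0)
        (fun u _ => by positivity) (Finset.mem_erase.2 ⟨hu0, hu⟩)
      simpa only [if_pos hAu] using this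
    linarith
  · have : q₁ A / (4 * ε * M) ≤ 1 := by linarith
    rwa [div_le_one (by positivity)] at this
  · have : q₂ A / (4 * ε) ≤ 1 := by linarith
    rwa [div_le_one (by positivity)] at this
  · intro d hd t ht hdt x u hu hlin
    by_contra! hcon
    have hmem : (d, t) ∈ I := by
      rw [hI, Finset.mem_filter, Finset.mem_product, Finset.mem_range, Finset.mem_range]
      exact ⟨⟨Nat.lt_succ_of_le hd, Nat.lt_succ_of_le ht⟩, hdt⟩
    have h₁ : tupleCount V₂ d t A ≤ q₃ A := le_q₃ A (d, t) hmem
    have h₂ := one_le_tupleCount hu hlin hcon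
    linarith

/-- A set of words without `t` linearly independent elements is small. -/
theorem card_le_of_no_linearIndependent (L : Finset (Word N)) (t : ℕ)
    (h : ∀ c : Fin t → Word N, (∀ i, c i ∈ L) → ¬ LinearIndependent (ZMod 2) c) :
    L.card ≤ 2 ^ t := by
  -- A maximal independent subset spans the whole set and has fewer than `t` elements.
  obtain ⟨b, hbL, hspan, hb⟩ := exists_linearIndependent (ZMod 2) (L : Set (Word N))
  have : Fintype b := Fintype.ofFinite _
  have hbt : Fintype.card b < t := by
    by_contra! hle
    obtain ⟨e⟩ : Nonempty (Fin t ↪ b) := Function.Embedding.nonempty_of_card_le (by simpa using hle)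
    exact h (fun i => (e i : Word N)) (fun i => by simpa using hbL (e i).2) (hb.comp e e.injective)
  have hcard : Nat.card (Submodule.span (ZMod 2) b) = 2 ^ Fintype.card b := by
    rw [Module.natCard_eq_pow_finrank (K := ZMod 2), finrank_span_set_eq_card hb, Nat.card_zmod,
      Set.toFinset_card]
  calc L.card = Nat.card (L : Set (Word N)) := by simp
    _ ≤ Nat.card (Submodule.span (ZMod 2) b) :=
      Nat.card_mono (Set.toFinite _) (hspan ▸ Submodule.subset_span)
    _ = 2 ^ Fintype.card b := hcard
    _ ≤ 2 ^ t := Nat.pow_le_pow_right two_pos hbt.le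

open Classical in
/-- Existence of nested linear codes `A V₂ ≤ A V`, the first one good for source coding with
respect to a ball of radius `d₁` and with small lists, the second one good for decoding of
noise vectors of weight at most `d₂`. -/
theorem exists_nested_code [Finite E] {V₂ V : Submodule (ZMod 2) E} {p ε : ℝ}
    (hp₀ : 0 ≤ p) (hp₁ : p ≤ 1) (hε : 0 < ε) {d₁ d₂ K₂ K : ℕ}
    (hK₂ : Nat.card V₂ = 2 ^ K₂) (hK : Nat.card V = 2 ^ K)
    (hN : (2 : ℝ) ^ K / 2 ^ N + ((N : ℝ) + 1) ^ 2 / 2 ^ N < 1 / 2)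
    (hsrc : (2 : ℝ) ^ N ≤ ε * (2 ^ K₂ * ballCard N d₁))
    (hchan : (2 : ℝ) ^ K * ballCard N d₂ ≤ ε * 2 ^ N) :
    ∃ A : E →ₗ[ZMod 2] Word N, (∀ u ∈ V, A u = 0 → u = 0) ∧
      (∀ ρ : ℝ, (d₁ : ℝ) ≤ ρ * N → srcErr (V₂.map A) ρ ≤ 4 * ε) ∧
      (∃ D : Word N → E, ∀ v ∈ V, (∑ z, if D (A v + z) = v then 0 else noiseProb p z) ≤
        4 * ε + ∑ z : Word N, if d₂ < hammingNorm z then noiseProb p z else 0) ∧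
      ∀ (ρ : ℝ) (d t : ℕ), d ≤ N → t ≤ N → ρ * N < d + 1 →
        (2 ^ K₂ * ballCard N d) ^ t * 2 ^ (2 * N) ≤ (2 ^ N) ^ t →
        ∀ x, (listDecode (V₂.map A) ρ x).card ≤ 2 ^ t := by
  let _ : Fintype E := Fintype.ofFinite _
  set T₂ : Finset E := Finset.univ.filter (· ∈ V₂) with hT₂
  set T : Finset E := Finset.univ.filter (· ∈ V) with hT
  have cT₂ : T₂.card = 2 ^ K₂ := by
    rw [← hK₂, Nat.card_eq_fintype_card, hT₂, Fintype.card_subtype]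
  have cT : T.card = 2 ^ K := by
    rw [← hK, Nat.card_eq_fintype_card, hT, Fintype.card_subtype]
  have mT₂ : ∀ u, u ∈ T₂ ↔ u ∈ V₂ := by simp [hT₂]
  have mT : ∀ u, u ∈ T ↔ u ∈ V := by simp [hT]
  obtain ⟨A, h₀, h₁, h₂, h₃⟩ := exists_good_linearMap (N := N) T₂ T hp₀ hp₁ hε d₁ d₂
    (by rw [cT]; exact_mod_cast hN) (by rw [cT₂]; exact_mod_cast hsrc)
    (by rw [cT]; exact_mod_cast hchan)
  have hinj : ∀ u ∈ V, A u = 0 → u = 0 := fun u hu hAu => by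
    by_contra h; exact h₀ u ((mT u).2 hu) h hAu
  refine ⟨A, hinj, ?_, ?_, ?_⟩
  · intro ρ hρ
    rw [srcErr_eq_sum, div_le_iff₀ (by positivity)]
    refine le_trans (Finset.sum_le_sum fun x _ => ?_) h₁
    unfold uncoveredInd
    by_cases hx : listEncode (V₂.map A) ρ x = none
    · rw [if_pos hx, if_pos]
      intro u hu hle
      refine listEncode_eq_none_iff.1 hx (A u) (Submodule.mem_map_of_mem ((mT₂ u).1 hu)) ?_
      rw [Word.hammingDist_eq]
      exact le_trans (by exact_mod_cast hle) hρ
    · rw [if_neg hx]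
      split_ifs <;> norm_num
  -- The decoder picks any codeword within distance `d₂`, with a default of `0`. It can fail only if
  -- the noise is heavier than `d₂` or if some nonzero `u ∈ V` has `z + A u` in the ball; the
  -- competitor `w` yields `u = v - w`, so the bound is the same for every `v`.
  · let P : Word N → E → Prop := fun y v => v ∈ V ∧ hammingNorm (y - A v) ≤ d₂
    refine ⟨fun y => if hy : ∃ v, P y v then hy.choose else 0, fun v hv => ?_⟩
    have hb : ∀ z : Word N, (if (if hy : ∃ w, P (A v + z) w then hy.choose else 0) = v
        then 0 else noiseProb p z) ≤
        (∑ u ∈ T.erase 0, noiseProb p z * ballInd d₂ (z + A u)) +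
          if d₂ < hammingNorm z then noiseProb p z else 0 := by
      intro z
      have nz := noiseProb_nonneg hp₀ hp₁ z
      have ns : 0 ≤ ∑ u ∈ T.erase 0, noiseProb p z * ballInd d₂ (z + A u) :=
        Finset.sum_nonneg fun u _ => mul_nonneg nz (ballInd_nonneg _ _)
      by_cases hz : d₂ < hammingNorm z
      · rw [if_pos hz]
        split_ifs <;> linarith
      · have hex : ∃ w, P (A v + z) w := ⟨v, hv, by simpa using not_lt.1 hz⟩
        rw [dif_pos hex, if_neg hz, add_zero]
        split_ifs with heq
        · exact ns
        · obtain ⟨hwV, hw⟩ := hex.choose_spec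
          set w := hex.choose
          have hmem : v - w ∈ T.erase 0 :=
            Finset.mem_erase.2 ⟨sub_ne_zero.2 (Ne.symm heq), (mT _).2 (V.sub_mem hv hwV)⟩
          refine le_trans (le_of_eq ?_) (Finset.single_le_sum
            (f := fun u => noiseProb p z * ballInd d₂ (z + A u))
            (fun u _ => mul_nonneg nz (ballInd_nonneg _ _)) hmem)
          have : z + A (v - w) = A v + z - A w := by rw [map_sub]; abel
          simp only [this, ballInd, if_pos hw, mul_one]
    refine (Finset.sum_le_sum fun z _ => hb z).trans ?_
    rw [Finset.sum_add_distrib, Finset.sum_comm]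
    gcongr
  · intro ρ d t hd ht hρ hdt x
    refine card_le_of_no_linearIndependent _ t fun c hc hlin => ?_
    have hc' : ∀ i, ∃ u ∈ V₂, A u = c i := fun i => (mem_listDecode.1 (hc i)).1
    choose u huV huc using hc'
    have hlin' : LinearIndependent (ZMod 2) u := by
      refine LinearIndependent.of_comp A ?_
      convert hlin using 1
      exact funext huc
    obtain ⟨i, hi⟩ := h₃ d hd t ht (by rw [cT₂]; exact hdt) x u (fun i => (mT₂ _).2 (huV i)) hlin'
    refine hi ?_
    have := (mem_listDecode.1 (hc i)).2.trans_lt hρ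
    rw [huc, ← Word.hammingDist_eq]
    exact Nat.lt_succ_iff.1 (by exact_mod_cast this)

/-- A linear map that is injective on a subspace agrees there with a linear equivalence. -/
theorem exists_linearEquiv_eqOn [Finite E] (hE : Module.finrank (ZMod 2) E = N)
    {V : Submodule (ZMod 2) E} {A : E →ₗ[ZMod 2] Word N} (hA : ∀ u ∈ V, A u = 0 → u = 0) :
    ∃ e : E ≃ₗ[ZMod 2] Word N, ∀ u ∈ V, e u = A u := by
  have : Module.Finite (ZMod 2) E := Module.Finite.of_finite
  have hdim : Module.finrank (ZMod 2) E = Module.finrank (ZMod 2) (Word N) := by simp [hE]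
  -- Since `A` is injective on `V`, complements of `V` and of its image have equal dimension and can
  -- be matched arbitrarily.
  obtain ⟨V', hV'⟩ := V.exists_isCompl
  have hinj : Function.Injective (A.domRestrict V) := by
    rw [← LinearMap.ker_eq_bot, LinearMap.ker_eq_bot']
    exact fun u hu => Subtype.ext (hA u u.2 hu)
  set R := LinearMap.range (A.domRestrict V) with hR
  obtain ⟨R', hR'⟩ := R.exists_isCompl
  let e₁ : V ≃ₗ[ZMod 2] R := LinearEquiv.ofInjective _ hinj
  have h' : Module.finrank (ZMod 2) V' = Module.finrank (ZMod 2) R' := by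
    have a := Submodule.finrank_add_eq_of_isCompl hV'
    have b := Submodule.finrank_add_eq_of_isCompl hR'
    have c := e₁.finrank_eq
    omega
  let e₂ : V' ≃ₗ[ZMod 2] R' := LinearEquiv.ofFinrankEq _ _ h'
  refine ⟨(V.prodEquivOfIsCompl V' hV').symm ≪≫ₗ (e₁.prodCongr e₂) ≪≫ₗ
    R.prodEquivOfIsCompl R' hR', fun u hu => ?_⟩
  have : (V.prodEquivOfIsCompl V' hV').symm u = (⟨u, hu⟩, 0) :=
    Submodule.prodEquivOfIsCompl_symm_apply_left _ _ hV' ⟨u, hu⟩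
  simp only [LinearEquiv.trans_apply, this, LinearEquiv.prodCongr_apply, map_zero,
    Submodule.coe_prodEquivOfIsCompl', ZeroMemClass.coe_zero, add_zero]
  rfl

end RandomCode

/-! ### Construction of nested codes -/

/-- The products `i g` have degree below `n`, so their coefficient vectors determine them, and `g ≠
0` can be cancelled. -/
theorem natCard_polyCode {F : Type} [Field F] [Finite F] {n k : ℕ} {g : F[X]} (hg : g.Monic)
    (hk : k + g.natDegree ≤ n) : Nat.card (polyCode n k g) = Nat.card F ^ k := by
  set f := (coeffVec F n ∘ₗ LinearMap.mulRight F g).domRestrict (Polynomial.degreeLT F k) with hf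
  have hinj : Function.Injective f := by
    rw [← LinearMap.ker_eq_bot, LinearMap.ker_eq_bot']
    rintro ⟨i, hi⟩ h0
    have hd := degree_mul_lt hg (Polynomial.mem_degreeLT.1 hi)
    have h := vecPoly_coeffVec (hd.trans_le (Nat.cast_le.2 hk))
    have h0' : coeffVec F n (i * g) = 0 := h0
    rw [h0'] at h
    have : i * g = 0 := by simpa [vecPoly] using h.symm
    exact Subtype.ext ((mul_eq_zero.1 this).resolve_right hg.ne_zero)
  have hr : polyCode n k g = LinearMap.range f := (LinearMap.range_domRestrict _ _).symm
  rw [hr, ← Nat.card_congr (LinearEquiv.ofInjective f hinj).toEquiv,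
    Nat.card_congr (Polynomial.degreeLTEquiv F k).toEquiv, Nat.card_fun]
  simp

/-- The symbolwise expansion of words in a basis. -/
noncomputable def symbolExpand {F : Type} [Field F] [Module (ZMod 2) F] {m : ℕ} (n : ℕ)
    (β : Module.Basis (Fin m) (ZMod 2) F) : (Fin n → F) ≃ₗ[ZMod 2] Word (n * m) :=
  LinearEquiv.piCongrRight (fun _ => β.equivFun) ≪≫ₗ
    (LinearEquiv.curry (ZMod 2) (ZMod 2) (Fin n) (Fin m)).symm ≪≫ₗ
    LinearEquiv.funCongrLeft (ZMod 2) (ZMod 2) finProdFinEquiv.symm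

theorem expand_apply {F : Type} [Field F] [Module (ZMod 2) F] {m n : ℕ}
    (β : Module.Basis (Fin m) (ZMod 2) F) (v : Fin n → F) (i : Fin n) (j : Fin m) :
    symbolExpand n β v (finProdFinEquiv (i, j)) = β.repr (v i) j := by
  simp [symbolExpand, LinearEquiv.funCongrLeft]

theorem exists_orderOf_galoisField {m : ℕ} (hm : 0 < m) :
    ∃ α : GaloisField 2 m, orderOf α = 2 ^ m - 1 := by
  obtain ⟨a, ha⟩ := IsCyclic.exists_ofOrder_eq_natCard (α := (GaloisField 2 m)ˣ)
  refine ⟨a, ?_⟩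
  rw [orderOf_units, ha, Nat.card_units, GaloisField.card 2 m hm.ne']

/-- The generator matrix of a linear equivalence, relative to the translation `φ`. -/
def generatorMatrix {E : Type*} [AddCommGroup E] [Module (ZMod 2) E] {b : ℕ}
    (φ : E ≃ₗ[ZMod 2] Word b) (e : E ≃ₗ[ZMod 2] Word (1 * b)) :
    Matrix (Fin b) (Fin b) (ZMod 2) :=
  fun j k => e (φ.symm (Pi.single j 1)) (Fin.cast (one_mul b).symm k)

theorem vecMul_generatorMatrix {E : Type*} [AddCommGroup E] [Module (ZMod 2) E] {b : ℕ}
    (φ : E ≃ₗ[ZMod 2] Word b) (e : E ≃ₗ[ZMod 2] Word (1 * b)) (u : Word b) (k : Fin b) :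
    Matrix.vecMul u (generatorMatrix φ e) k = e (φ.symm u) (Fin.cast (one_mul b).symm k) := by
  conv_rhs => rw [pi_eq_sum_univ' u]
  simp only [map_sum, map_smul, Finset.sum_apply, Pi.smul_apply, smul_eq_mul, Matrix.vecMul,
    dotProduct, generatorMatrix]

/-- The nested Reed-Solomon codes with one group of bits whose concatenated encoder is a given
linear equivalence `e`. -/
noncomputable def nestedOfEquiv {m k₁ k₂ : ℕ} (hm : 0 < m) (hk₁ : 0 < k₁) (hk₂ : 0 < k₂)
    (hk : k₁ + k₂ < 2 ^ m - 1) {α : GaloisField 2 m} (hα : orderOf α = 2 ^ m - 1)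
    (β : Module.Basis (Fin m) (ZMod 2) (GaloisField 2 m))
    (e : (Fin (2 ^ m - 1) → GaloisField 2 m) ≃ₗ[ZMod 2] Word (1 * ((2 ^ m - 1) * m))) :
    NestedRS where
  m := m
  n := 2 ^ m - 1
  k₁ := k₁
  k₂ := k₂
  l := 1
  b := (2 ^ m - 1) * m
  M := (2 ^ m - 1) * m
  m_pos := hm
  k₁_pos := hk₁
  k₂_pos := hk₂
  k_lt := hk
  l_pos := one_pos
  l_le := by omega
  groups := one_mul _
  α := α
  order_α := hα
  φ := symbolExpand _ β
  G := generatorMatrix (symbolExpand _ β) e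
  G_inj u v huv := by
    refine (symbolExpand _ β).symm.injective (e.injective (funext fun x => ?_))
    have h := congrFun huv (Fin.cast (one_mul _) x)
    simp only [vecMul_generatorMatrix] at h
    exact h

section

variable {m k₁ k₂ : ℕ} {hm : 0 < m} {hk₁ : 0 < k₁} {hk₂ : 0 < k₂}
  {hk : k₁ + k₂ < 2 ^ m - 1} {α : GaloisField 2 m} {hα : orderOf α = 2 ^ m - 1}
  {β : Module.Basis (Fin m) (ZMod 2) (GaloisField 2 m)}
  {e : (Fin (2 ^ m - 1) → GaloisField 2 m) ≃ₗ[ZMod 2] Word (1 * ((2 ^ m - 1) * m))}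

/-- With one group the block index is always `0`, so the blockwise encoder is a single
multiplication by the matrix of `e`. -/
theorem nestedOfEquiv_conc (v : Fin (2 ^ m - 1) → GaloisField 2 m) :
    (nestedOfEquiv hm hk₁ hk₂ hk hα β e).conc v = e v := by
  set S := nestedOfEquiv hm hk₁ hk₂ hk hα β e with hS
  funext x
  have h₁ : (fun j : Fin S.b => symbolExpand _ β v
      (Fin.cast S.groups (finProdFinEquiv (Fin.divNat (m := S.l) x, j)))) = symbolExpand _ β v := by
    funext j
    refine congrArg (symbolExpand _ β v) (Fin.ext ?_)
    have : (Fin.divNat (m := S.l) x : ℕ) = 0 := Nat.lt_one_iff.1 (Fin.divNat (m := S.l) x).2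
    change (j : ℕ) + S.b * (Fin.divNat (m := S.l) x : ℕ) = j
    rw [this, mul_zero, add_zero]
  have h₂ : S.conc v x = Matrix.vecMul (fun j : Fin S.b => symbolExpand _ β v
      (Fin.cast S.groups (finProdFinEquiv (Fin.divNat (m := S.l) x, j))))
      (generatorMatrix (symbolExpand _ β) e) (Fin.modNat (m := S.l) x) := rfl
  have h₃ := vecMul_generatorMatrix (symbolExpand _ β) e (symbolExpand _ β v)
    (Fin.modNat (m := S.l) x)
  rw [LinearEquiv.symm_apply_apply] at h₃
  refine h₂.trans ((congrArg (fun w => Matrix.vecMul w (generatorMatrix (symbolExpand _ β) e)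
    (Fin.modNat (m := S.l) x)) h₁).trans (h₃.trans (congrArg (e v) (Fin.ext ?_))))
  have hx : (x : ℕ) < 1 * ((2 ^ m - 1) * m) := x.2
  rw [one_mul] at hx
  exact Nat.mod_eq_of_lt hx

theorem nestedOfEquiv_symbolwise : (nestedOfEquiv hm hk₁ hk₂ hk hα β e).Symbolwise :=
  ⟨β, fun v i j => expand_apply β v i j⟩

end

/-- Nested codes of given dimensions that are good for source and channel coding. -/
theorem exists_nestedRS {m k₁ k₂ N d₁ d₂ : ℕ} {p ε t : ℝ} (hm : 0 < m) (hk₁ : 0 < k₁)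
    (hk₂ : 0 < k₂) (hk : k₁ + k₂ < 2 ^ m - 1) (hNm : 1 * ((2 ^ m - 1) * m) = N)
    (hp₀ : 0 ≤ p) (hp₁ : p ≤ 1) (hε : 0 < ε) (ht : 0 < t)
    (hN : (2 : ℝ) ^ ((k₁ + k₂) * m) / 2 ^ N + ((N : ℝ) + 1) ^ 2 / 2 ^ N < 1 / 2)
    (hsrc : (2 : ℝ) ^ N ≤ ε * (2 ^ (k₂ * m) * ballCard N d₁))
    (hchan : (2 : ℝ) ^ ((k₁ + k₂) * m) * ballCard N d₂ ≤ ε * 2 ^ N)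
    (hd₂ : p * N + t ≤ d₂ + 1) :
    ∃ (S : NestedRS) (D : S.Decoder), S.m = m ∧ S.n = 2 ^ m - 1 ∧ S.k₁ = k₁ ∧ S.k₂ = k₂ ∧
      S.N = N ∧ S.Symbolwise ∧
      (∀ ρ : ℝ, (d₁ : ℝ) ≤ ρ * N → srcErr S.Ceq₂ ρ ≤ 4 * ε) ∧
      (∀ v ∈ S.outer, S.chanErr D p v ≤ 4 * ε + N / t ^ 2) ∧
      ∀ (ρ : ℝ) (d t : ℕ), d ≤ N → t ≤ N → ρ * N < d + 1 →
        (2 ^ (k₂ * m) * ballCard N d) ^ t * 2 ^ (2 * N) ≤ (2 ^ N) ^ t →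
        ∀ x, (listDecode S.Ceq₂ ρ x).card ≤ 2 ^ t := by
  subst hNm
  obtain ⟨α, hα⟩ := exists_orderOf_galoisField hm
  have : Module.Finite (ZMod 2) (GaloisField 2 m) := Module.Finite.of_finite
  have hrank : Module.finrank (ZMod 2) (GaloisField 2 m) = m := GaloisField.finrank 2 hm.ne'
  let β : Module.Basis (Fin m) (ZMod 2) (GaloisField 2 m) := Module.finBasisOfFinrankEq _ _ hrank
  -- A provisional bijection: the outer codes do not depend on the inner encoder, so they can be
  -- formed before the random map is chosen.
  let e₀ : (Fin (2 ^ m - 1) → GaloisField 2 m) ≃ₗ[ZMod 2] Word (1 * ((2 ^ m - 1) * m)) :=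
    symbolExpand _ β ≪≫ₗ LinearEquiv.funCongrLeft (ZMod 2) (ZMod 2) (finCongr (one_mul _))
  set S₀ := nestedOfEquiv hm hk₁ hk₂ hk hα β e₀ with hS₀
  have hcard : Nat.card (GaloisField 2 m) = 2 ^ m := GaloisField.card 2 m hm.ne'
  have c₂ : Nat.card S₀.outer₂ = 2 ^ (k₂ * m) := by
    rw [NestedRS.outer₂, natCard_polyCode (S₀.g_monic.mul S₀.f_monic)
      (by rw [S₀.natDegree_gf]; have := S₀.k_lt; omega)]
    rw [mul_comm, pow_mul]
    exact congrArg (· ^ k₂) hcard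
  have c : Nat.card S₀.outer = 2 ^ ((k₁ + k₂) * m) := by
    rw [NestedRS.outer, natCard_polyCode S₀.g_monic
      (by rw [S₀.natDegree_g]; have := S₀.k_lt; omega)]
    rw [mul_comm, pow_mul]
    exact congrArg (· ^ (k₁ + k₂)) hcard
  obtain ⟨A, hA, hs, ⟨D, hD⟩, hl⟩ := exists_nested_code (N := 1 * ((2 ^ m - 1) * m))
    (V₂ := S₀.outer₂.restrictScalars (ZMod 2)) (V := S₀.outer.restrictScalars (ZMod 2))
    hp₀ hp₁ hε c₂ c hN hsrc hchan
  obtain ⟨e, he⟩ := exists_linearEquiv_eqOn (N := 1 * ((2 ^ m - 1) * m))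
    (V := S₀.outer.restrictScalars (ZMod 2)) (A := A)
    (e₀.finrank_eq.trans (by simp)) hA
  set S := nestedOfEquiv hm hk₁ hk₂ hk hα β e with hS
  have hconc : ∀ v ∈ S₀.outer, S.conc v = A v := fun v hv =>
    (nestedOfEquiv_conc v).trans (he v hv)
  have hC : S.Ceq₂ = (S₀.outer₂.restrictScalars (ZMod 2)).map A := by
    ext x
    simp only [NestedRS.Ceq₂, Submodule.mem_map, Submodule.restrictScalars_mem]
    constructor
    · rintro ⟨v, hv, rfl⟩
      exact ⟨v, hv, (hconc v (S₀.outer₂_le_outer hv)).symm⟩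
    · rintro ⟨v, hv, rfl⟩
      exact ⟨v, hv, hconc v (S₀.outer₂_le_outer hv)⟩
  refine ⟨S, D, rfl, rfl, rfl, rfl, rfl, nestedOfEquiv_symbolwise, ?_, ?_, ?_⟩
  · rw [hC]; exact hs
  · intro v hv
    have h : S.chanErr D p v ≤ 4 * ε + ∑ z : Word (1 * ((2 ^ m - 1) * m)),
        if d₂ < hammingNorm z then noiseProb p z else 0 := by
      refine le_trans (le_of_eq (Finset.sum_congr rfl
        fun (z : Word (1 * ((2 ^ m - 1) * m))) _ => ?_)) (hD v hv)
      have e₁ := congrArg (fun w : Word (1 * ((2 ^ m - 1) * m)) => D (w + z)) (hconc v hv)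
      by_cases hz : D (A v + z) = v
      · exact (if_pos (e₁.trans hz)).trans (if_pos hz).symm
      · exact (if_neg fun h' => hz (e₁.symm.trans h')).trans (if_neg hz).symm
    refine h.trans (add_le_add_right ((Finset.sum_le_sum fun z _ => ?_).trans
      (noise_tail hp₀ hp₁ ht _)) _)
    -- Weights are integers, so exceeding `d₂` means being at least `d₂ + 1 ≥ p N + t`.
    by_cases hz : d₂ < hammingNorm z
    · rw [if_pos hz, if_pos]
      have : (d₂ : ℝ) + 1 ≤ hammingNorm z := by exact_mod_cast hz
      exact le_trans (by linarith) (le_abs_self _)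
    · rw [if_neg hz]
      split_ifs
      · exact noiseProb_nonneg hp₀ hp₁ z
      · exact le_rfl
  · rw [hC]; exact hl

/-! ### Asymptotics of the construction -/

theorem pow_le_pow_mul_iff {a b : ℕ} {B : ℝ} (hB : 0 < B) :
    (2 : ℝ) ^ a ≤ 2 ^ b * B ↔ (a : ℝ) ≤ b + Real.logb 2 B := by
  rw [← Real.logb_le_logb one_lt_two (by positivity) (by positivity),
    Real.logb_mul (by positivity) hB.ne', Real.logb_pow, Real.logb_pow,
    Real.logb_self_eq_one one_lt_two, mul_one, mul_one]

theorem pow_mul_le_pow_iff {a b : ℕ} {B : ℝ} (hB : 0 < B) :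
    (2 : ℝ) ^ b * B ≤ 2 ^ a ↔ b + Real.logb 2 B ≤ (a : ℝ) := by
  rw [← Real.logb_le_logb one_lt_two (by positivity) (by positivity),
    Real.logb_mul (by positivity) hB.ne', Real.logb_pow, Real.logb_pow,
    Real.logb_self_eq_one one_lt_two, mul_one, mul_one]

/-- The length of a primitive Reed-Solomon code over the field with `2 ^ m` elements. -/
def rsLength (m : ℕ) : ℕ := 2 ^ m - 1

/-- The length of the binary image of a primitive Reed-Solomon code. -/
def bitLength (m : ℕ) : ℕ := 1 * (rsLength m * m)

theorem self_le_rsLength (m : ℕ) : m ≤ rsLength m := Nat.le_sub_one_of_lt Nat.lt_two_pow_self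

theorem bitLength_eq (m : ℕ) : (bitLength m : ℝ) = rsLength m * m := by
  simp [bitLength]

theorem rsLength_pos {m : ℕ} (hm : 0 < m) : 0 < rsLength m := hm.trans_le (self_le_rsLength m)

theorem tendsto_rsLength : Tendsto rsLength atTop atTop :=
  tendsto_atTop_mono self_le_rsLength tendsto_id

theorem tendsto_bitLength : Tendsto bitLength atTop atTop := by
  refine tendsto_atTop_mono' _ ?_ tendsto_id
  filter_upwards [eventually_gt_atTop 0] with m hm
  rw [bitLength, one_mul]
  exact Nat.le_mul_of_pos_left m (rsLength_pos hm)

/-- This ratio is the Chebyshev tail `N / n ^ 2` for `N = n m` and a deviation of `n = rsLength m`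
from the mean weight. -/
theorem tendsto_self_div_rsLength :
    Tendsto (fun m : ℕ => (m : ℝ) / rsLength m) atTop (𝓝 0) := by
  have h : Tendsto (fun m : ℕ => 2 * ((m : ℝ) ^ 1 / 2 ^ m)) atTop (𝓝 (2 * 0)) :=
    (tendsto_pow_const_div_const_pow_of_one_lt 1 one_lt_two).const_mul 2
  rw [mul_zero] at h
  refine squeeze_zero' (Eventually.of_forall fun m => by positivity) ?_ h
  filter_upwards [eventually_gt_atTop 0] with m hm
  have h₁ : (2 : ℝ) ^ m ≤ 2 * rsLength m := by
    have h2 : 2 ≤ 2 ^ m := Nat.le_self_pow hm.ne' 2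
    have : 2 ^ m ≤ 2 * rsLength m := by unfold rsLength; omega
    exact_mod_cast this
  have h₂ : (0 : ℝ) < rsLength m := by exact_mod_cast rsLength_pos hm
  rw [pow_one, ← mul_div_assoc, div_le_div_iff₀ h₂ (by positivity)]
  nlinarith [Nat.cast_nonneg (α := ℝ) m]

theorem eventually_small_fractions :
    ∀ᶠ m in atTop, ((2 : ℝ) ^ m)⁻¹ + ((bitLength m : ℝ) + 1) ^ 2 / 2 ^ bitLength m < 1 / 2 := by
  have h₁ : Tendsto (fun m : ℕ => ((2 : ℝ) ^ m)⁻¹) atTop (𝓝 0) :=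
    (tendsto_pow_atTop_atTop_of_one_lt one_lt_two).inv_tendsto_atTop
  have h₂ : Tendsto (fun n : ℕ => ((n : ℝ) + 1) ^ 2 / 2 ^ n) atTop (𝓝 0) := by
    have := (tendsto_pow_const_div_const_pow_of_one_lt 2 (one_lt_two (α := ℝ))).comp
      (tendsto_add_atTop_nat 1)
    have := this.const_mul 2
    rw [mul_zero] at this
    refine this.congr fun n => ?_
    simp only [Function.comp, pow_succ]
    push_cast
    field_simp
  have := h₁.add (h₂.comp tendsto_bitLength)
  rw [add_zero] at this
  exact this.eventually_lt_const (by norm_num)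

/-- The exact number of redundancy bits matched to a ball gives the rate `1 - h`, up to rounding. -/
theorem tendsto_div_rsLength {d k : ℕ → ℕ} {ρ : ℝ}
    (hd : Tendsto (fun m => (d m : ℝ) / bitLength m) atTop (𝓝 ρ))
    (hdN : ∀ᶠ m in atTop, 2 * d m ≤ bitLength m)
    (hk : ∀ m, |(k m : ℝ) - (bitLength m - Real.logb 2 (ballCard (bitLength m) (d m))) / m| ≤ 2) :
    Tendsto (fun m => (k m : ℝ) / rsLength m) atTop (𝓝 (1 - h2 ρ)) := by
  have hL := tendsto_logb_ballCard tendsto_bitLength hd hdN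
  have hn : Tendsto (fun m => (rsLength m : ℝ)) atTop atTop :=
    tendsto_natCast_atTop_atTop.comp tendsto_rsLength
  have hr : Tendsto (fun m => (2 : ℝ) / rsLength m) atTop (𝓝 0) := tendsto_const_nhds.div_atTop hn
  have hdiff : Tendsto (fun m => (k m : ℝ) / rsLength m -
      (1 - Real.logb 2 (ballCard (bitLength m) (d m)) / bitLength m)) atTop (𝓝 0) := by
    refine squeeze_zero_norm' ?_ hr
    filter_upwards [eventually_gt_atTop 0] with m hm
    have hm' : (0 : ℝ) < m := by exact_mod_cast hm
    have hn' : (0 : ℝ) < rsLength m := by exact_mod_cast rsLength_pos hm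
    have e : (k m : ℝ) / rsLength m -
        (1 - Real.logb 2 (ballCard (bitLength m) (d m)) / bitLength m) =
        ((k m : ℝ) - (bitLength m - Real.logb 2 (ballCard (bitLength m) (d m))) / m)
          / rsLength m := by
      rw [bitLength_eq]; field_simp
    rw [e, Real.norm_eq_abs, abs_div, abs_of_pos hn']
    exact div_le_div_of_nonneg_right (hk m) hn'.le
  have := hdiff.add ((tendsto_const_nhds (x := (1 : ℝ))).sub hL)
  rw [zero_add] at this
  exact this.congr fun m => by ring

theorem eventually_exists_nestedRS {p W : ℝ} (hp₀ : 0 ≤ p) (hpW : p < W) (hW : W ≤ 1 / 2) :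
    ∃ k k₂ : ℕ → ℕ,
      Tendsto (fun m => (k m : ℝ) / rsLength m) atTop (𝓝 (1 - h2 p)) ∧
      Tendsto (fun m => (k₂ m : ℝ) / rsLength m) atTop (𝓝 (1 - h2 W)) ∧
      ∀ᶠ m in atTop, ∃ (S : NestedRS) (D : S.Decoder), S.m = m ∧ S.n = 2 ^ m - 1 ∧
        S.k₁ + S.k₂ = k m ∧ S.k₂ = k₂ m ∧ S.N = bitLength m ∧ S.Symbolwise ∧
        srcErr S.Ceq₂ W ≤ 4 * ((2 : ℝ) ^ m)⁻¹ ∧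
        (∀ v ∈ S.outer, S.chanErr D p v ≤ 4 * ((2 : ℝ) ^ m)⁻¹ + m / rsLength m) ∧
        ∀ (ρ : ℝ) (d t : ℕ), d ≤ bitLength m → t ≤ bitLength m → ρ * bitLength m < d + 1 →
          (2 ^ (k₂ m * m) * ballCard (bitLength m) d) ^ t * 2 ^ (2 * bitLength m) ≤
            (2 ^ bitLength m) ^ t →
          ∀ x, (listDecode S.Ceq₂ ρ x).card ≤ 2 ^ t := by
  have hW₀ : 0 < W := hp₀.trans_lt hpW
  have hNr : Tendsto (fun m => (bitLength m : ℝ)) atTop atTop :=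
    tendsto_natCast_atTop_atTop.comp tendsto_bitLength
  set d₁ : ℕ → ℕ := fun m => ⌊W * bitLength m⌋₊ with hd₁
  -- The margin `n = N / m` is `o(N)`, so the rate is unaffected, yet it is large compared with
  -- `√N`, so the noise rarely exceeds it.
  set d₂ : ℕ → ℕ := fun m => ⌊p * bitLength m⌋₊ + rsLength m with hd₂
  have td₁ : Tendsto (fun m => (d₁ m : ℝ) / bitLength m) atTop (𝓝 W) :=
    (tendsto_nat_floor_mul_div_atTop hW₀.le).comp hNr
  have td₂ : Tendsto (fun m => (d₂ m : ℝ) / bitLength m) atTop (𝓝 p) := by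
    have h₁ := ((tendsto_nat_floor_mul_div_atTop hp₀).comp hNr).add
      (tendsto_one_div_atTop_nhds_zero_nat (𝕜 := ℝ))
    rw [add_zero] at h₁
    refine h₁.congr' ?_
    filter_upwards [eventually_gt_atTop 0] with m hm
    have hm' : (0 : ℝ) < m := by exact_mod_cast hm
    have hn' : (0 : ℝ) < rsLength m := by exact_mod_cast rsLength_pos hm
    simp only [Function.comp, hd₂]
    push_cast
    rw [add_div]
    congr 1
    rw [bitLength_eq]
    field_simp
  have b₁ : ∀ m, 2 * d₁ m ≤ bitLength m := by
    intro m
    have h : (d₁ m : ℝ) ≤ W * bitLength m := Nat.floor_le (by positivity)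
    have : (2 : ℝ) * d₁ m ≤ bitLength m := by nlinarith [Nat.cast_nonneg (α := ℝ) (bitLength m)]
    exact_mod_cast this
  have b₂ : ∀ᶠ m in atTop, 2 * d₂ m ≤ bitLength m := by
    filter_upwards [td₂.eventually_lt_const (hpW.trans_le hW),
      tendsto_bitLength.eventually_gt_atTop 0] with m hm h0
    have h0' : (0 : ℝ) < bitLength m := by exact_mod_cast h0
    rw [div_lt_iff₀ h0'] at hm
    have : (2 : ℝ) * d₂ m ≤ bitLength m := by linarith
    exact_mod_cast this
  set L₁ : ℕ → ℝ := fun m => Real.logb 2 (ballCard (bitLength m) (d₁ m)) with hL₁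
  set L₂ : ℕ → ℝ := fun m => Real.logb 2 (ballCard (bitLength m) (d₂ m)) with hL₂
  -- One symbol more than covering by volume requires, and below one symbol fewer than packing
  -- allows. The spare `m` bits give the factor `ε = 2 ^ (-m)` in both counting conditions.
  set k₂ : ℕ → ℕ := fun m => ⌈(bitLength m - L₁ m) / m⌉₊ + 1 with hk₂
  set k : ℕ → ℕ := fun m => ⌊(bitLength m - L₂ m) / m⌋₊ - 1 with hk
  have logb_ball : ∀ m d, 0 ≤ bitLength m - Real.logb 2 (ballCard (bitLength m) d) := by
    intro m d
    have h : (ballCard (bitLength m) d : ℝ) ≤ 2 ^ bitLength m := by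
      have : ballCard (bitLength m) d ≤ 2 ^ bitLength m := by
        rw [← card_word]; exact Finset.card_le_univ _
      exact_mod_cast this
    have := (pow_mul_le_pow_iff (a := bitLength m) (b := 0)
      (Nat.cast_pos.2 (ballCard_pos (bitLength m) d))).1 (by simpa using h)
    push_cast at this
    linarith
  have tk₂ : Tendsto (fun m => (k₂ m : ℝ) / rsLength m) atTop (𝓝 (1 - h2 W)) := by
    refine tendsto_div_rsLength td₁ (Eventually.of_forall b₁) fun m => ?_
    have h0 : 0 ≤ (bitLength m - L₁ m) / m := div_nonneg (logb_ball m (d₁ m)) (by positivity)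
    have h₁ := Nat.le_ceil ((bitLength m - L₁ m) / m)
    have h₂ := Nat.ceil_lt_add_one h0
    simp only [hk₂]
    push_cast
    rw [abs_le]
    constructor <;> linarith
  have tk : Tendsto (fun m => (k m : ℝ) / rsLength m) atTop (𝓝 (1 - h2 p)) := by
    refine tendsto_div_rsLength td₂ b₂ fun m => ?_
    have h0 : 0 ≤ (bitLength m - L₂ m) / m := div_nonneg (logb_ball m (d₂ m)) (by positivity)
    have h₁ := Nat.floor_le h0
    have h₂ := Nat.lt_floor_add_one ((bitLength m - L₂ m) / m)
    have h₃ : (k m : ℝ) ≤ ⌊(bitLength m - L₂ m) / m⌋₊ := by exact_mod_cast Nat.sub_le _ _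
    have h₄ : (⌊(bitLength m - L₂ m) / m⌋₊ : ℝ) ≤ k m + 1 := by
      have : ⌊(bitLength m - L₂ m) / m⌋₊ ≤ k m + 1 := by simp only [hk]; omega
      exact_mod_cast this
    rw [abs_le]
    constructor <;> linarith
  refine ⟨k, k₂, tk, tk₂, ?_⟩
  -- This strict gap, coming from `p < W`, makes `k₁ = k - k₂` eventually positive.
  have hlt : 1 - h2 W < 1 - h2 p := sub_lt_sub_left
    (h2_strictMonoOn ⟨hp₀, (hpW.le.trans hW)⟩ ⟨hW₀.le, hW⟩ hpW) _
  filter_upwards [tk₂.eventually_lt tk hlt, eventually_small_fractions,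
    eventually_gt_atTop 0] with m h₁ h₂ hm
  have hm' : (0 : ℝ) < m := by exact_mod_cast hm
  have hn' : (0 : ℝ) < rsLength m := by exact_mod_cast rsLength_pos hm
  have hkk : k₂ m < k m := by
    rw [div_lt_div_iff_of_pos_right hn'] at h₁
    exact_mod_cast h₁
  have hk₂_pos : 0 < k₂ m := Nat.succ_pos _
  have hsrc : (bitLength m : ℝ) + m ≤ k₂ m * m + L₁ m := by
    have := Nat.le_ceil ((bitLength m - L₁ m) / m)
    rw [div_le_iff₀ hm'] at this
    simp only [hk₂]
    push_cast
    linarith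
  have hchan : (k m : ℝ) * m + m + L₂ m ≤ bitLength m := by
    have hf : k m + 1 = ⌊(bitLength m - L₂ m) / m⌋₊ := by
      have : 0 < k m := hk₂_pos.trans hkk
      simp only [hk] at this ⊢
      omega
    have := Nat.floor_le (div_nonneg (logb_ball m (d₂ m)) hm'.le)
    rw [← hf, le_div_iff₀ hm'] at this
    push_cast at this
    linarith
  have hL₂0 : 0 ≤ L₂ m := Real.logb_nonneg one_lt_two (by exact_mod_cast ballCard_pos _ _)
  have hkn : k m < rsLength m := by
    rw [bitLength_eq] at hchan
    have : (k m : ℝ) * m < rsLength m * m := by linarith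
    exact_mod_cast lt_of_mul_lt_mul_right this hm'.le
  have hsum : k m - k₂ m + k₂ m = k m := Nat.sub_add_cancel hkk.le
  obtain ⟨S, D, e₁, e₂, e₃, e₄, e₅, e₆, e₇, e₈, e₉⟩ := exists_nestedRS (m := m)
    (k₁ := k m - k₂ m) (k₂ := k₂ m) (N := bitLength m) (d₁ := d₁ m) (d₂ := d₂ m) (p := p)
    (ε := ((2 : ℝ) ^ m)⁻¹) (t := rsLength m) hm (Nat.sub_pos_of_lt hkk) hk₂_pos
    (by rw [hsum]; exact hkn) rfl hp₀ (by linarith) (by positivity) hn'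
    (by
      -- The spare symbol also gives `2 ^ K / 2 ^ N ≤ 2 ^ (-m)`, which is what injectivity on the
      -- outer code needs.
      refine lt_of_le_of_lt (add_le_add_left ?_ _) h₂
      rw [hsum, div_le_iff₀ (by positivity), inv_mul_eq_div, le_div_iff₀ (by positivity), ← pow_add]
      refine pow_le_pow_right₀ one_le_two ?_
      have : (k m : ℝ) * m + m ≤ bitLength m := by linarith
      exact_mod_cast this)
    (by
      rw [inv_mul_eq_div, le_div_iff₀ (by positivity), ← pow_add,
        pow_le_pow_mul_iff (Nat.cast_pos.2 (ballCard_pos _ _))]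
      push_cast
      exact hsrc)
    (by
      rw [hsum, inv_mul_eq_div, le_div_iff₀ (by positivity), mul_right_comm, ← pow_add,
        pow_mul_le_pow_iff (Nat.cast_pos.2 (ballCard_pos _ _))]
      push_cast
      exact hchan)
    (by
      have := Nat.lt_floor_add_one (p * bitLength m)
      simp only [hd₂]
      push_cast
      linarith)
  refine ⟨S, D, e₁, e₂, by rw [e₃, e₄, hsum], e₄, e₅, e₆, e₇ W ?_, fun v hv => ?_, e₉⟩
  · exact Nat.floor_le (by positivity)
  · refine (e₈ v hv).trans_eq ?_
    rw [bitLength_eq]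
    field_simp

/-- Nested Reed-Solomon codes with random inner codes are good for source coding with small lists
and achieve the capacity of the binary symmetric channel. -/
theorem exists_good_nestedRS {p W : ℝ} (hp₀ : 0 ≤ p) (hpW : p < W) (hW : W ≤ 1 / 2) :
    ∃ (S : ℕ → NestedRS) (D : ∀ i, (S i).Decoder),
      Tendsto (fun i => (S i).N) atTop atTop ∧
      (∀ i, (S i).n = 2 ^ (S i).m - 1 ∧ (S i).Symbolwise) ∧
      GoodSourceCodes S W ∧
      (∀ ρ < W, ∃ c : ℕ, ∀ᶠ i in atTop, ∀ x : Word (S i).N,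
        (listDecode (S i).Ceq₂ ρ x).card ≤ (S i).N ^ c) ∧
      AchieveCapacity S D p := by
  obtain ⟨k, k₂, tk, tk₂, hS⟩ := eventually_exists_nestedRS hp₀ hpW hW
  obtain ⟨m₀, hm₀⟩ := eventually_atTop.1 (hS.and (eventually_gt_atTop 0))
  choose S D em en ek ek₂ eN esym esrc echan elist using
    fun i : ℕ => (hm₀ (i + m₀) (Nat.le_add_left _ _)).1
  have pos : ∀ i, 0 < i + m₀ := fun i => (hm₀ (i + m₀) (Nat.le_add_left _ _)).2
  have shift : Tendsto (fun i => i + m₀) atTop atTop := tendsto_add_atTop_nat m₀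
  have hN : Tendsto (fun i => (S i).N) atTop atTop := by
    simp_rw [eN]; exact tendsto_bitLength.comp shift
  have hinv : Tendsto (fun m : ℕ => 4 * ((2 : ℝ) ^ m)⁻¹) atTop (𝓝 0) := by
    have := ((tendsto_pow_atTop_atTop_of_one_lt (one_lt_two (α := ℝ))).inv_tendsto_atTop).const_mul 4
    rwa [mul_zero] at this
  have rate_eq : ∀ (i a : ℕ), (a : ℝ) * ((i + m₀ : ℕ) : ℝ) / bitLength (i + m₀) =
      (a : ℝ) / rsLength (i + m₀) := by
    intro i a
    have hm' : (0 : ℝ) < (i + m₀ : ℕ) := by exact_mod_cast pos i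
    have hn' : (0 : ℝ) < rsLength (i + m₀) := by exact_mod_cast rsLength_pos (pos i)
    rw [bitLength_eq, mul_div_mul_right _ _ hm'.ne']
  have hrate₂ : Tendsto (fun i => (S i).rate₂) atTop (𝓝 (1 - h2 W)) := by
    refine (tk₂.comp shift).congr fun i => ?_
    rw [NestedRS.rate₂, ek₂, em, eN, rate_eq]
    rfl
  refine ⟨S, D, hN, fun i => ⟨by rw [en, em], esym i⟩, ⟨hrate₂, ?_⟩, ?_, ⟨?_, ?_⟩⟩
  · exact squeeze_zero (fun i => by unfold srcErr; positivity) esrc (hinv.comp shift)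
  · intro ρ hρ
    -- For negative radius the lists are empty once `N > 0`.
    rcases lt_or_ge ρ 0 with hneg | hρ₀
    · refine ⟨0, ?_⟩
      filter_upwards [hN.eventually_gt_atTop 0] with i hi x
      have hi' : (0 : ℝ) < (S i).N := by exact_mod_cast hi
      have : listDecode (S i).Ceq₂ ρ x = ∅ := by
        refine Finset.eq_empty_of_forall_notMem fun c hc => ?_
        have h₁ := (mem_listDecode.1 hc).2
        have h₂ : ρ * (S i).N < 0 := mul_neg_of_neg_of_pos hneg hi'
        have h₃ : (0 : ℝ) ≤ hammingDist x c := Nat.cast_nonneg _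
        linarith
      simp [this]
    · have hW₀ : 0 < W := hp₀.trans_lt hpW
      have hNr : Tendsto (fun m => (bitLength m : ℝ)) atTop atTop :=
        tendsto_natCast_atTop_atTop.comp tendsto_bitLength
      have td : Tendsto (fun m => (⌊ρ * bitLength m⌋₊ : ℝ) / bitLength m) atTop (𝓝 ρ) :=
        (tendsto_nat_floor_mul_div_atTop hρ₀).comp hNr
      have hdN : ∀ m, 2 * ⌊ρ * bitLength m⌋₊ ≤ bitLength m := by
        intro m
        have h : (⌊ρ * bitLength m⌋₊ : ℝ) ≤ ρ * bitLength m := Nat.floor_le (by positivity)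
        have : (2 : ℝ) * ⌊ρ * bitLength m⌋₊ ≤ bitLength m := by
          nlinarith [Nat.cast_nonneg (α := ℝ) (bitLength m)]
        exact_mod_cast this
      have tL := tendsto_logb_ballCard tendsto_bitLength td (Eventually.of_forall hdN)
      have hgap : 0 < h2 W - h2 ρ :=
        sub_pos.2 (h2_strictMonoOn ⟨hρ₀, (hρ.le.trans hW)⟩ ⟨hW₀.le, hW⟩ hρ)
      -- Each extra independent element of a list costs a factor of about `2 ^ (-N (h(W) - h(ρ)))`.
      -- This `t` beats the factor `2 ^ (2 N)`, so the lists have at most `2 ^ t` elements, a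
      -- constant, which is at most `N ^ t`.
      obtain ⟨t, ht⟩ := exists_nat_gt (2 / (h2 W - h2 ρ))
      rw [div_lt_iff₀ hgap] at ht
      have tgap := ((tendsto_const_nhds (x := (1 : ℝ))).sub ((tk₂.add tL).comp shift)).const_mul
        (t : ℝ)
      have hev := tgap.eventually_const_lt (u := 2) (by
        have : (1 : ℝ) - (1 - h2 W + h2 ρ) = h2 W - h2 ρ := by ring
        rwa [this])
      refine ⟨t, ?_⟩
      filter_upwards [hev, hN.eventually_ge_atTop t, hN.eventually_ge_atTop 2] with i h₁ h₂ h₃ x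
      refine (elist i ρ ⌊ρ * bitLength (i + m₀)⌋₊ t ?_ ?_ (Nat.lt_floor_add_one _) ?_ x).trans
        (Nat.pow_le_pow_left h₃ t)
      · have := hdN (i + m₀); omega
      · rwa [← eN]
      · have hB : (0 : ℝ) < ballCard (bitLength (i + m₀)) ⌊ρ * bitLength (i + m₀)⌋₊ :=
          Nat.cast_pos.2 (ballCard_pos _ _)
        simp only [Function.comp] at h₁
        rw [← rate_eq, ← add_div] at h₁
        have hN0 : (0 : ℝ) < bitLength (i + m₀) := by
          rw [← eN]; exact_mod_cast (by omega : 0 < (S i).N)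
        have h₄ := mul_lt_mul_of_pos_right h₁ hN0
        have key := (pow_mul_le_pow_iff (a := bitLength (i + m₀) * t)
          (b := k₂ (i + m₀) * (i + m₀) * t + 2 * bitLength (i + m₀)) (pow_pos hB t)).2 (by
            rw [Real.logb_pow]
            rw [mul_assoc, sub_mul, div_mul_cancel₀ _ hN0.ne'] at h₄
            push_cast at h₄ ⊢
            linarith)
        have e : ((2 ^ (k₂ (i + m₀) * (i + m₀)) *
            ballCard (bitLength (i + m₀)) ⌊ρ * bitLength (i + m₀)⌋₊) ^ t *
              2 ^ (2 * bitLength (i + m₀)) : ℝ) ≤ (2 ^ bitLength (i + m₀)) ^ t := by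
          rw [← pow_mul]
          refine le_trans (le_of_eq ?_) key
          rw [pow_add, pow_mul, mul_pow]
          ring
        exact_mod_cast e
  · refine (tk.comp shift).congr fun i => ?_
    rw [NestedRS.rate, ek, em, eN, rate_eq]
    rfl
  · intro ε hε
    have := ((hinv.add tendsto_self_div_rsLength).comp shift)
    rw [add_zero] at this
    filter_upwards [this.eventually_lt_const hε] with i hi v hv
    exact (echan i v hv).trans hi.le

/-! ### Existence, the nested scheme, and time sharing combined. -/

theorem proposition4 (p : ℝ) (hp₀ : 0 ≤ p) (hp : p < 1 / 2) :
    -- nested codes which are good source codes and capacity-achieving channel codes exist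
    (∀ W : ℝ, p < W → W ≤ 1 / 2 →
      ∃ (S : ℕ → NestedRS) (D : ∀ i, (S i).Decoder),
        Tendsto (fun i => (S i).N) atTop atTop ∧
        (∀ i, (S i).n = 2 ^ (S i).m - 1 ∧ (S i).Symbolwise) ∧
        GoodSourceCodes S W ∧
        (∀ ρ < W, ∃ c : ℕ, ∀ᶠ i in atTop, ∀ x : Word (S i).N,
          (listDecode (S i).Ceq₂ ρ x).card ≤ (S i).N ^ c) ∧
        AchieveCapacity S D p) ∧
    -- the resulting scheme achieves the rate `h(W) - h(p)`
    (∀ W : ℝ, p < W → W ≤ 1 / 2 →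
      ∀ (S : ℕ → NestedRS) (D : ∀ i, (S i).Decoder),
        Tendsto (fun i => (S i).N) atTop atTop →
        GoodSourceCodes S W → AchieveCapacity S D p →
        SchemesAchieve S D W (fun _ => 0) W p (h2 W - h2 p)) ∧
    -- with time sharing, it achieves the whole capacity-noise bound
    (∀ W : ℝ, 0 < W → W ≤ 1 / 2 →
      ∃ ω : ℝ, p < ω ∧ W ≤ ω ∧ ω ≤ 1 / 2 ∧ (RGP W p = h2 W - h2 p → ω = W) ∧
        ∀ (S : ℕ → NestedRS) (D : ∀ i, (S i).Decoder),
          Tendsto (fun i => (S i).N) atTop atTop →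
          GoodSourceCodes S ω → AchieveCapacity S D p →
          SchemesAchieve S D ω (fun i => ⌈((S i).N : ℝ) * (ω / W - 1)⌉₊) W p (RGP W p)) := by
  refine ⟨fun W hpW hW => exists_good_nestedRS hp₀ hpW hW, fun W hpW hW S D hN hS hD => ?_,
    fun W hW₀ hW => ?_⟩
  · have hW₀ : 0 < W := hp₀.trans_lt hpW
    -- The case `ω = W` of the time-shared scheme, where `ω / W - 1 = 0` and no idling is needed.
    have h := hS.schemesAchieve hp₀ (by linarith) hW₀ hW₀ hD (a := fun _ => 0)
      (fun i => by simp [div_self hW₀.ne']) (by simp [div_self hW₀.ne']) hN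
    rwa [div_self hW₀.ne', one_mul] at h
  · obtain ⟨ω, hpω, hWω, hω, hunique, hR⟩ := exists_RGP_eq hp₀ hp hW₀ hW
    refine ⟨ω, hpω, hWω, hω, hunique, fun S D hN hS hD => ?_⟩
    rw [hR]
    have hnonneg : 0 ≤ ω / W - 1 := sub_nonneg.2 ((one_le_div hW₀).2 hWω)
    refine hS.schemesAchieve hp₀ (by linarith) hW₀ (hW₀.trans_le hWω) hD
      (fun i => Nat.le_ceil _) ?_ hN
    have := (tendsto_nat_ceil_mul_div_atTop hnonneg).comp
      (tendsto_natCast_atTop_atTop (R := ℝ) |>.comp hN)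
    simpa only [Function.comp_def, mul_comm] using this
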